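/- **Game model.** Consider a finite dynamic game with perfect recall: finitely many players $i\in\mathcal I=\{1,\dots,I\}$ and times $t\in\mathcal T=\{1,\dots,T\}$. At time $t$ every player $i$ takes an action $U_t^i\in\mathcal U_t^i$, obtains a reward $R_t^i\in[-1,1]$ and then learns $Z_t^i\in\mathcal Z_t^i$, where $(X_{t+1},Z_t,R_t)=f_t(X_t,U_t,W_t)$. The primitive random variables $(X_1,H_1)$ with $H_1=(H_1^i)_i$, and $W_1,\dots,W_T$, are mutually independent with given laws. All spaces are finite. The information of player $i$ at time $t$ is $H_t^i=(H_1^i,Z_1^i,\dots,Z_{t-1}^i)$, and $U_t^i$ is a function of $Z_t^i$. Let $\mathcal H_t^i$ be the set of values that $H_t^i$ can take. A behavioral strategy of player $i$ is a family $g^i=(g_t^i)_t$ with $g_t^i:\mathcal H_t^i\to\Delta(\mathcal U_t^i)$. A profile $g=(g^i)_i$ is *fully mixed* if $g_t^i(u\mid h)>0$ for all $i,t,h,u$. A superscript $g^{-i}$ on a conditional probability or expectation given $(h_t^i,u_t^i)$ means that it is the same under every strategy of player $i$ that gives the condition positive probability. **Four notions of sequential equilibrium** for a profile $g$. All convergence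 is pointwise. 1. *Model-based.* Let $P_t^i:\mathcal H_t^i\times\mathcal U_t^i\to\Delta(\mathcal Z_t^i)$ for $t<T$ and $r_t^i:\mathcal H_t^i\times\mathcal U_t^i\to[-1,1]$ for $t\le T$. Put $J_{T+1}^i=0$ and $$J_t^i(\sigma;h)=\sum_u\Big[r_t^i(h,u)+\sum_z J_{t+1}^i(\sigma;(h,z))\,P_t^i(z\mid h,u)\Big]\sigma_t(u\mid h),$$ where $z$ runs over the values with $(h,z)\in\mathcal H_{t+1}^i$, and the sum over $z$ is absent for $t=T$. The triple $(g,P,r)$ is an equilibrium if (a) $J_t^i(g^i;h)\ge J_t^i(\sigma;h)$ for all $i,t$, $h\in\mathcal H_t^i$ and all strategies $\sigma$ of player $i$; and (b) there are $(g^{(n)},P^{(n)},r^{(n)})\to(g,P,r)$ with $g^{(n)}$ fully mixed, $P_t^{(n),i}(z\mid h,u)=\Pr^{g^{(n),-i}}(Z_t^i=z\mid h,u)$ and $r_t^{(n),i}(h,u)=\mathbb E^{g^{(n),-i}}[R_t^i\mid h,u]$. 2. *Model-free, version 1.* Let $Q_t^i:\mathcal H_t^i\times\mathcal U_t^i\to[-T,T]$.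 The pair $(g,Q)$ is an equilibrium if (a) $\operatorname{supp}g_t^i(h)\subseteq\arg\max_uQ_t^i(h,u)$ for all $i,t,h$; and (b) there are $(g^{(n)},Q^{(n)})\to(g,Q)$ with $g^{(n)}$ fully mixed and $Q_\tau^{(n),i}(h,u)=\mathbb E^{g^{(n)}}\big[\sum_{t=\tau}^TR_t^i\mid h,u\big]$ for all $i,\tau,h,u$. 3. *Model-free, version 2.* As in 2, with the last equation replaced by $$Q_\tau^{(n),i}(h,u)=\mathbb E^{g^{(n),-i}}[R_\tau^i\mid h,u]+\max_{\sigma_{\tau+1:T}}\mathbb E^{\sigma_{\tau+1:T},\,g^{(n),-i}}\Big[\sum_{t=\tau+1}^TR_t^i\,\Big|\,h,u\Big],$$ the maximum being over strategies of player $i$ from time $\tau+1$ on. 4. *Classical (Kreps–Wilson).* In the game tree, at each time the players move in the order $1,\dots,I$ and then nature moves. Let $\mathcal O_t^i$ be the set of nodes $o=(x_1,h_1,w_{1:t-1},u_{1:t-1},u_t^1,\dots,u_t^{i-1})$, $O_t^i$ the random node at which player $i$ moves at time $t$, and $\Lambda^i=\sum_{t=1}^TR_t^i$. For beliefs $\mu_t^i:\mathcal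 H_t^i\to\Delta(\mathcal O_t^i)$ the assessment $(g,\mu)$ is an equilibrium if (a) for all $i,t$, $h\in\mathcal H_t^i$ and all strategies $\sigma$ of player $i$, $$\sum_o\mathbb E^{g}[\Lambda^i\mid o]\,\mu_t^i(o\mid h)\ \ge\ \sum_o\mathbb E^{(\sigma,g^{-i})}[\Lambda^i\mid o]\,\mu_t^i(o\mid h),$$ where $\mathbb E[\,\cdot\mid o]$ is taken over play that starts from the node $o$; and (b) there are $(g^{(n)},\mu^{(n)})\to(g,\mu)$ with $g^{(n)}$ fully mixed and $\mu_t^{(n),i}(o\mid h)=\Pr^{g^{(n)}}(O_t^i=o\mid H_t^i=h)$ for all $i,t,h,o$. **Theorem.** For every behavioral strategy profile $g$ the following are equivalent: there are $(P,r)$ such that $(g,P,r)$ is a model-based sequential equilibrium; there is $Q$ such that $(g,Q)$ is a model-free sequential equilibrium (version 1); there is $Q$ such that $(g,Q)$ is a model-free sequential equilibrium (version 2); there is $\mu$ such that $(g,\mu)$ is a classical sequential equilibrium. -/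

import Mathlib

open Filter Topology
open scoped Classical

universe u v

noncomputable section

/-- A finite dynamic game with player set `ι` and horizon `T`.  The timestamps `1, …, T` are the
elements of `Fin T` (counted from `0`).  `X_{t+1}`, `Z_t`, `R_t` are given by
`f_t (X_t, U_t, W_t)`; the primitive random variables are `(X_1, H_1)`, with law `initLaw`, and the
`W_t`, with law `noiseLaw t`, all mutually independent. -/
structure DynamicGame (ι : Type v) [Fintype ι] [LinearOrder ι] (T : ℕ) where
  /-- states -/
  X : Fin (T + 1) → Type u
  /-- actions -/
  U : Fin T → ι → Type u
  /-- information increments -/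
  Z : Fin T → ι → Type u
  /-- moves of nature -/
  W : Fin T → Type u
  /-- initial information -/
  H₁ : ι → Type u
  fintypeX : ∀ t, Fintype (X t)
  fintypeU : ∀ t i, Fintype (U t i)
  fintypeZ : ∀ t i, Fintype (Z t i)
  fintypeW : ∀ t, Fintype (W t)
  fintypeH₁ : ∀ i, Fintype (H₁ i)
  nonemptyU : ∀ t i, Nonempty (U t i)
  initLaw : stdSimplex ℝ (X 0 × (∀ i, H₁ i))
  noiseLaw : ∀ t, stdSimplex ℝ (W t)
  f : ∀ t : Fin T, X t.castSucc → (∀ i, U t i) → W t → X t.succ × (∀ i, Z t i) × (ι → ℝ)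
  /-- rewards lie in `[-1, 1]` -/
  reward_mem : ∀ t x a w i, (f t x a w).2.2 i ∈ Set.Icc (-1 : ℝ) 1
  /-- the action of a player is contained in the new information of that player -/
  action_recall : ∀ t i, ∃ act : Z t i → U t i, ∀ x a w, act ((f t x a w).2.1 i) = a i

namespace DynamicGame

attribute [instance] fintypeX fintypeU fintypeZ fintypeW fintypeH₁ nonemptyU

variable {ι : Type v} [Fintype ι] [LinearOrder ι] {T : ℕ} (G : DynamicGame.{u, v} ι T)

/-! ### Outcomes and random variables -/

/-- The possible values of `(X_1, H_1)`. -/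
abbrev Init : Type (max u v) := {a : G.X 0 × (∀ i, G.H₁ i) // 0 < G.initLaw.1 a}

/-- The possible values of `W_t`. -/
abbrev Noise (t : Fin T) : Type u := {w : G.W t // 0 < (G.noiseLaw t).1 w}

/-- Outcomes `(x_1, h_1, u_{1:T}, w_{1:T})`: all moves of nature and of the players.  These are
also the terminal nodes of the game tree. -/
abbrev Outcome : Type (max u v) := G.Init × (∀ t : Fin T, (∀ i, G.U t i) × G.Noise t)

/-- `U_t^i`. -/
def action (t : Fin T) (i : ι) (ω : G.Outcome) : G.U t i := (ω.2 t).1 i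

/-- `X_t`. -/
def state (ω : G.Outcome) (t : Fin (T + 1)) : G.X t :=
  Fin.induction (motive := G.X) ω.1.1.1 (fun s x => (G.f s x (ω.2 s).1 (ω.2 s).2.1).1) t

/-- `Z_t^i`. -/
def info (t : Fin T) (i : ι) (ω : G.Outcome) : G.Z t i :=
  (G.f t (G.state ω t.castSucc) (ω.2 t).1 (ω.2 t).2.1).2.1 i

/-- `R_t^i`. -/
def reward (t : Fin T) (i : ι) (ω : G.Outcome) : ℝ :=
  (G.f t (G.state ω t.castSucc) (ω.2 t).1 (ω.2 t).2.1).2.2 i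

/-- Tuples `(h_1^i, z_{1:t-1}^i)`. -/
abbrev RawHist (t : Fin T) (i : ι) : Type u := G.H₁ i × (∀ s : {s : Fin T // s < t}, G.Z s.1 i)

/-- `H_t^i = (H_1^i, Z_{1:t-1}^i)`. -/
def hist (t : Fin T) (i : ι) (ω : G.Outcome) : G.RawHist t i :=
  (ω.1.1.2 i, fun s => G.info s.1 i ω)

/-- The space `𝓗_t^i` of values that `H_t^i` can take, i.e. the information sets of player `i` at
time `t`. -/
abbrev Hist (t : Fin T) (i : ι) : Type u := Set.range (G.hist t i)

/-- `H_t^i` as an `𝓗_t^i`-valued random variable. -/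
def H (t : Fin T) (i : ι) (ω : G.Outcome) : G.Hist t i := ⟨G.hist t i ω, ω, rfl⟩

/-! ### Strategies and probabilities -/

/-- Behavioral strategies `g^i = (g_t^i)_t`, `g_t^i : 𝓗_t^i → Δ(𝓤_t^i)`, of player `i`. -/
abbrev Strategy (i : ι) : Type u := ∀ t : Fin T, G.Hist t i → stdSimplex ℝ (G.U t i)

/-- Behavioral strategy profiles. -/
abbrev Profile : Type (max u v) := ∀ i, G.Strategy i

variable {G}

/-- Every action is chosen with positive probability at every information set. -/
def FullyMixed (g : G.Profile) : Prop := ∀ i t h a, 0 < (g i t h).1 a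

/-- The factor contributed by the move of player `i` at time `t` to the probability of `ω`. -/
def moveProb (g : G.Profile) (t : Fin T) (i : ι) (ω : G.Outcome) : ℝ :=
  (g i t (G.H t i ω)).1 (G.action t i ω)

/-- The factor contributed by the move of nature at time `t` to the probability of `ω`. -/
def noiseProb (t : Fin T) (ω : G.Outcome) : ℝ := (G.noiseLaw t).1 (ω.2 t).2.1

/-- The probability of the outcome `ω` under the profile `g`. -/
def prob (g : G.Profile) (ω : G.Outcome) : ℝ :=
  G.initLaw.1 ω.1.1 * ∏ t, ((∏ i, moveProb g t i ω) * noiseProb t ω)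

/-- `Pr^g(A)`. -/
def pr (g : G.Profile) (A : Set G.Outcome) : ℝ := ∑ ω with ω ∈ A, prob g ω

/-- `Pr^g(B | A)`, meaningful when `Pr^g(A) ≠ 0`. -/
def condPr (g : G.Profile) (B A : Set G.Outcome) : ℝ := pr g (B ∩ A) / pr g A

/-- `E^g[F | A]`, meaningful when `Pr^g(A) ≠ 0`. -/
def condE (g : G.Profile) (F : G.Outcome → ℝ) (A : Set G.Outcome) : ℝ :=
  (∑ ω with ω ∈ A, prob g ω * F ω) / pr g A

/-- The event `H_t^i = h`. -/
def evH {t : Fin T} {i : ι} (h : G.Hist t i) : Set G.Outcome := {ω | G.H t i ω = h}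

/-- The event `H_t^i = h, U_t^i = a`. -/
def evHU {t : Fin T} {i : ι} (h : G.Hist t i) (a : G.U t i) : Set G.Outcome :=
  {ω | G.H t i ω = h ∧ G.action t i ω = a}

/-- The profile `(σ, g^{-i})`. -/
abbrev deviate (g : G.Profile) (i : ι) (σ : G.Strategy i) : G.Profile := Function.update g i σ

/-- `c = Pr^{g^{-i}}(B | A)`: the conditional probability of `B` given `A` is `c` under every
completion of `g^{-i}` that gives `A` a nonzero probability. -/
def IsPartialCondPr (g : G.Profile) (i : ι) (B A : Set G.Outcome) (c : ℝ) : Prop :=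
  ∀ σ : G.Strategy i, pr (deviate g i σ) A ≠ 0 → condPr (deviate g i σ) B A = c

/-- `c = E^{g^{-i}}[F | A]`: the conditional expectation of `F` given `A` is `c` under every
completion of `g^{-i}` that gives `A` a nonzero probability. -/
def IsPartialCondE (g : G.Profile) (i : ι) (F : G.Outcome → ℝ) (A : Set G.Outcome) (c : ℝ) : Prop :=
  ∀ σ : G.Strategy i, pr (deviate g i σ) A ≠ 0 → condE (deviate g i σ) F A = c

/-! ### Model-based sequential equilibrium -/

variable (G) in
/-- Conjectured transition kernels `P_t^i : 𝓗_t^i × 𝓤_t^i → Δ(𝓩_t^i)`, for all timestamps but the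
last one. -/
abbrev Kernels : Type (max u v) :=
  ∀ (i : ι) (t : {t : Fin T // (t : ℕ) + 1 < T}),
    G.Hist t.1 i → G.U t.1 i → stdSimplex ℝ (G.Z t.1 i)

variable (G) in
/-- Conjectured reward functions `r_t^i : 𝓗_t^i × 𝓤_t^i → [-1, 1]`. -/
abbrev Rewards : Type (max u v) :=
  ∀ (i : ι) (t : Fin T), G.Hist t i → G.U t i → Set.Icc (-1 : ℝ) 1

/-- The tuple `k = (h_1^i, z_{1:s-1}^i)` cut down to `(h_1^i, z_{1:t-1}^i)`, for `t ≤ s`. -/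
def RawHist.restrict {s t : Fin T} {i : ι} (hts : t ≤ s) (k : G.RawHist s i) : G.RawHist t i :=
  (k.1, fun q => k.2 ⟨q.1, q.2.trans_le hts⟩)

/-- The reward-to-go `J_t^i(σ_{t:T}; h, P^i, r^i)`.  The sum over `k` runs over the histories
`k = (h, z)` in `𝓗_{t+1}^i`, and `z` is the last component of `k`. -/
def rewardToGo {i : ι} (P : G.Kernels) (r : G.Rewards) (σ : G.Strategy i) (t : ℕ) (ht : t < T)
    (h : G.Hist ⟨t, ht⟩ i) : ℝ :=
  ∑ a : G.U ⟨t, ht⟩ i,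
    ((r i ⟨t, ht⟩ h a : ℝ) +
      if hs : t + 1 < T then
        ∑ k : G.Hist ⟨t + 1, hs⟩ i with
            RawHist.restrict (Fin.mk_le_mk.2 (Nat.le_succ t)) k.1 = h.1,
          rewardToGo P r σ (t + 1) hs k *
            (P i ⟨⟨t, ht⟩, hs⟩ h a).1 (k.1.2 ⟨⟨t, ht⟩, Fin.mk_lt_mk.2 (Nat.lt_succ_self t)⟩)
      else 0) * (σ ⟨t, ht⟩ h).1 a
termination_by T - t

/-- `g` is sequentially rational under `(P, r)`. -/
def RationalUnderModel (g : G.Profile) (P : G.Kernels) (r : G.Rewards) : Prop :=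
  ∀ (i : ι) (t : Fin T) (h : G.Hist t i) (σ : G.Strategy i),
    rewardToGo P r σ t t.2 h ≤ rewardToGo P r (g i) t t.2 h

/-- `(P^i, r^i)` is consistent with `g^{-i}` for every player `i`. -/
def ModelConsistent (g : G.Profile) (P : G.Kernels) (r : G.Rewards) : Prop :=
  ∀ (i : ι) (t : Fin T) (h : G.Hist t i) (a : G.U t i),
    (∀ (hs : (t : ℕ) + 1 < T) (z : G.Z t i),
      IsPartialCondPr g i {ω | G.info t i ω = z} (evHU h a) ((P i ⟨t, hs⟩ h a).1 z)) ∧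
    IsPartialCondE g i (G.reward t i) (evHU h a) (r i t h a)

/-- `(P, r)` is fully consistent with `g`. -/
def ModelFullyConsistent (g : G.Profile) (P : G.Kernels) (r : G.Rewards) : Prop :=
  ∃ (gs : ℕ → G.Profile) (Ps : ℕ → G.Kernels) (rs : ℕ → G.Rewards),
    (∀ n, FullyMixed (gs n)) ∧ (∀ n, ModelConsistent (gs n) (Ps n) (rs n)) ∧
    Tendsto gs atTop (𝓝 g) ∧ Tendsto Ps atTop (𝓝 P) ∧ Tendsto rs atTop (𝓝 r)

/-- `(g, P, r)` is a model-based sequential equilibrium. -/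
def IsModelBasedSE (g : G.Profile) (P : G.Kernels) (r : G.Rewards) : Prop :=
  RationalUnderModel g P r ∧ ModelFullyConsistent g P r

/-! ### Model-free sequential equilibrium, both versions -/

variable (G) in
/-- History-action value functions `Q_t^i : 𝓗_t^i × 𝓤_t^i → [-T, T]`. -/
abbrev QFunctions : Type (max u v) :=
  ∀ (i : ι) (t : Fin T), G.Hist t i → G.U t i → Set.Icc (-(T : ℝ)) (T : ℝ)

/-- `g` is sequentially rational under `Q`: `supp (g_t^i(h)) ⊆ argmax_a Q_t^i(h, a)`. -/
def RationalUnderQ (g : G.Profile) (Q : G.QFunctions) : Prop :=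
  ∀ (i : ι) (t : Fin T) (h : G.Hist t i),
    {a | (g i t h).1 a ≠ 0} ⊆ {a | ∀ b, (Q i t h b : ℝ) ≤ Q i t h a}

/-- Consistency of `Q` with `g`:
`Q_τ^i(h, a) = E^g[∑_{t ≥ τ} R_t^i | h, a]`. -/
def QConsistent (g : G.Profile) (Q : G.QFunctions) : Prop :=
  ∀ (i : ι) (τ : Fin T) (h : G.Hist τ i) (a : G.U τ i),
    (Q i τ h a : ℝ) = condE g (fun ω => ∑ t ∈ Finset.Ici τ, G.reward t i ω) (evHU h a)

/-- Consistency of `Q^i` with `g^{-i}` for every player `i`: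
`Q_τ^i(h, a) = E^{g^{-i}}[R_τ^i | h, a] + max_σ E^{σ, g^{-i}}[∑_{t > τ} R_t^i | h, a]`.
The maximum is over the strategies `σ` of player `i` under which the condition is admissible; the
conditional expectation does not depend on `σ_{1:τ}`. -/
def QConsistentMax (g : G.Profile) (Q : G.QFunctions) : Prop :=
  ∀ (i : ι) (τ : Fin T) (h : G.Hist τ i) (a : G.U τ i), ∃ ρ m : ℝ,
    IsPartialCondE g i (G.reward τ i) (evHU h a) ρ ∧
    IsGreatest {x : ℝ | ∃ σ : G.Strategy i, pr (deviate g i σ) (evHU h a) ≠ 0 ∧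
      x = condE (deviate g i σ) (fun ω => ∑ t ∈ Finset.Ioi τ, G.reward t i ω) (evHU h a)} m ∧
    (Q i τ h a : ℝ) = ρ + m

/-- `Q` is fully consistent with `g`. -/
def QFullyConsistent (g : G.Profile) (Q : G.QFunctions) : Prop :=
  ∃ (gs : ℕ → G.Profile) (Qs : ℕ → G.QFunctions),
    (∀ n, FullyMixed (gs n)) ∧ (∀ n, QConsistent (gs n) (Qs n)) ∧
    Tendsto gs atTop (𝓝 g) ∧ Tendsto Qs atTop (𝓝 Q)

/-- `Q` is fully consistent with `g`, in the second version. -/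
def QFullyConsistentMax (g : G.Profile) (Q : G.QFunctions) : Prop :=
  ∃ (gs : ℕ → G.Profile) (Qs : ℕ → G.QFunctions),
    (∀ n, FullyMixed (gs n)) ∧ (∀ n, QConsistentMax (gs n) (Qs n)) ∧
    Tendsto gs atTop (𝓝 g) ∧ Tendsto Qs atTop (𝓝 Q)

/-- `(g, Q)` is a model-free sequential equilibrium. -/
def IsModelFreeSE (g : G.Profile) (Q : G.QFunctions) : Prop :=
  RationalUnderQ g Q ∧ QFullyConsistent g Q

/-- `(g, Q)` is a model-free sequential equilibrium, version 2. -/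
def IsModelFreeSE₂ (g : G.Profile) (Q : G.QFunctions) : Prop :=
  RationalUnderQ g Q ∧ QFullyConsistentMax g Q

/-! ### Classical sequential equilibrium -/

variable (G) in
/-- Nodes `o_t^i = (x_1, h_1, w_{1:t-1}, u_{1:t-1}, u_t^{<i})` of the game tree in which the
players move one after another, in increasing order, at each time and nature moves last. -/
abbrev Node (t : Fin T) (i : ι) : Type (max u v) :=
  G.Init × (∀ s : {s : Fin T // s < t}, (∀ j, G.U s.1 j) × G.Noise s.1) ×
    (∀ j : {j : ι // j < i}, G.U t j.1)

variable (G) in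
/-- `O_t^i`: the node at which player `i` moves at time `t`. -/
def node (t : Fin T) (i : ι) (ω : G.Outcome) : G.Node t i :=
  (ω.1, fun s => ω.2 s.1, fun j => G.action t j.1 ω)

variable (G) in
/-- The total payoff `Λ^i` at a terminal node. -/
def payoff (i : ι) (ω : G.Outcome) : ℝ := ∑ t, G.reward t i ω

/-- The probability of the moves along `ω` that come at or after the node `O_t^i`: the moves of the
players `j ≥ i` and of nature at time `t`, and all moves at the times `s > t`. -/
def contProb (g : G.Profile) (t : Fin T) (i : ι) (ω : G.Outcome) : ℝ :=
  ((∏ j ∈ Finset.univ.filter (fun j => i ≤ j), moveProb g t j ω) * noiseProb t ω) *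
    ∏ s ∈ Finset.Ioi t, ((∏ j, moveProb g s j ω) * noiseProb s ω)

/-- `E^g[F(O_{T+1}) | o]`, the expectation of `F` at the terminal node when play starts from the
node `o` and follows `g`. -/
def contE (g : G.Profile) {t : Fin T} {i : ι} (F : G.Outcome → ℝ) (o : G.Node t i) : ℝ :=
  ∑ ω with G.node t i ω = o, contProb g t i ω * F ω

variable (G) in
/-- Belief systems `μ_t^i : 𝓗_t^i → Δ(𝓞_t^i)`. -/
abbrev Beliefs : Type (max u v) :=
  ∀ (i : ι) (t : Fin T), G.Hist t i → stdSimplex ℝ (G.Node t i)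

/-- `g` is sequentially rational given `μ`. -/
def RationalGiven (g : G.Profile) (μ : G.Beliefs) : Prop :=
  ∀ (i : ι) (t : Fin T) (h : G.Hist t i) (σ : G.Strategy i),
    ∑ o, contE (deviate g i σ) (G.payoff i) o * (μ i t h).1 o ≤
      ∑ o, contE g (G.payoff i) o * (μ i t h).1 o

/-- `μ` is consistent with `g`: `μ_t^i(o | h) = Pr^g(o | h)`. -/
def BeliefConsistent (g : G.Profile) (μ : G.Beliefs) : Prop :=
  ∀ (i : ι) (t : Fin T) (h : G.Hist t i) (o : G.Node t i),
    (μ i t h).1 o = condPr g {ω | G.node t i ω = o} (evH h)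

/-- `μ` is fully consistent with `g`. -/
def BeliefFullyConsistent (g : G.Profile) (μ : G.Beliefs) : Prop :=
  ∃ (gs : ℕ → G.Profile) (μs : ℕ → G.Beliefs),
    (∀ n, FullyMixed (gs n)) ∧ (∀ n, BeliefConsistent (gs n) (μs n)) ∧
    Tendsto gs atTop (𝓝 g) ∧ Tendsto μs atTop (𝓝 μ)

/-- The assessment `(g, μ)` is a (classical) sequential equilibrium. -/
def IsClassicalSE (g : G.Profile) (μ : G.Beliefs) : Prop :=
  RationalGiven g μ ∧ BeliefFullyConsistent g μ

end DynamicGame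

end

noncomputable section

namespace DynamicGame

variable {ι : Type v} [Fintype ι] [LinearOrder ι] {T : ℕ} {G : DynamicGame.{u, v} ι T}

/-! The model-based notion is the hub: each of the other three is shown equivalent to it. All four
consistency conditions refer to fully mixed profiles converging to `g`. Under a fully mixed profile
every information set has positive probability, so consistent `P`, `r`, `Q` and `μ` all exist. They
live in compact metrizable spaces, so along a subsequence any missing ones converge too
(`exists_convergent_choice`). Hence it suffices to fix one sequence that carries both kinds of
objects and to show that the two rationality conditions agree in the limit. Rationality is never
needed along the sequence.

The bridge is that each player faces a Markov decision process whose state is the player's own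
history. By perfect recall `(h, u)` fixes all earlier own moves (`ownProb_eq`). Their probability is
thus a common factor of numerator and denominator, and conditional laws of time-`t` data given `(h,
u)` do not depend on the player's own strategy (`FullyMixed.condE_deviate`). Backward induction then
identifies the reward-to-go in a consistent model with the true conditional expectation of future
rewards, for every own strategy (`wsum_rewardToGo`).

Consequently `Q` of version 1 is the action value in the model with continuation `g⁽ⁿ⁾`, and `Q` of
version 2 is the one with an optimal continuation. The expected payoff under consistent beliefs is a
past term that does not involve the deviation, plus the reward-to-go (`sum_contE_mul_belief`).
Action values are continuous, so these descriptions survive in the limit. Version 1 then follows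
from the one-shot deviation principle (`rationalUnderModel_iff`). Version 2 follows because limits
of optimal strategies are optimal and rationality may be tested against any optimal continuation
(`rationalUnderModel_iff_of_optimal`). In the classical case the past term cancels when two
strategies are compared. -/

/-! ### Outcomes that agree before a given time -/

/-- The outcomes have the same initial move and the same moves at all times before `n`. -/
def Agree (n : ℕ) (ω ω' : G.Outcome) : Prop :=
  ω.1 = ω'.1 ∧ ∀ s : Fin T, (s : ℕ) < n → ω.2 s = ω'.2 s

namespace Agree

theorem refl (n : ℕ) (ω : G.Outcome) : Agree n ω ω := ⟨rfl, fun _ _ => rfl⟩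

theorem symm {n : ℕ} {ω ω' : G.Outcome} (h : Agree n ω ω') : Agree n ω' ω :=
  ⟨h.1.symm, fun s hs => (h.2 s hs).symm⟩

theorem trans {n : ℕ} {ω ω' ω'' : G.Outcome} (h : Agree n ω ω') (h' : Agree n ω' ω'') :
    Agree n ω ω'' :=
  ⟨h.1.trans h'.1, fun s hs => (h.2 s hs).trans (h'.2 s hs)⟩

theorem mono {m n : ℕ} (hmn : m ≤ n) {ω ω' : G.Outcome} (h : Agree n ω ω') : Agree m ω ω' :=
  ⟨h.1, fun s hs => h.2 s (hs.trans_le hmn)⟩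

theorem state_eq {ω ω' : G.Outcome} (t : Fin (T + 1)) :
    Agree (t : ℕ) ω ω' → G.state ω t = G.state ω' t := by
  induction t using Fin.induction with
  | zero => intro h; simp only [state, Fin.induction_zero, h.1]
  | succ s ih =>
    intro h
    have h1 := ih (h.mono (by simp))
    simp only [state, Fin.induction_succ] at h1 ⊢
    rw [h1, h.2 s (by simp)]

theorem f_eq {ω ω' : G.Outcome} {t : Fin T} (h : Agree (t + 1) ω ω') :
    G.f t (G.state ω t.castSucc) (ω.2 t).1 (ω.2 t).2.1 =
      G.f t (G.state ω' t.castSucc) (ω'.2 t).1 (ω'.2 t).2.1 := by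
  rw [state_eq t.castSucc (h.mono (by simp)), h.2 t (Nat.lt_succ_self _)]

theorem info_eq {ω ω' : G.Outcome} {t : Fin T} (h : Agree (t + 1) ω ω') (i : ι) :
    G.info t i ω = G.info t i ω' := by
  unfold info; rw [h.f_eq]

theorem reward_eq {ω ω' : G.Outcome} {t : Fin T} (h : Agree (t + 1) ω ω') (i : ι) :
    G.reward t i ω = G.reward t i ω' := by
  unfold reward; rw [h.f_eq]

theorem action_eq {ω ω' : G.Outcome} {t : Fin T} (h : Agree (t + 1) ω ω') (i : ι) :
    G.action t i ω = G.action t i ω' := by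
  unfold action; rw [h.2 t (Nat.lt_succ_self _)]

theorem H_eq {ω ω' : G.Outcome} {t : Fin T} (h : Agree t ω ω') (i : ι) :
    G.H t i ω = G.H t i ω' := by
  refine Subtype.ext (Prod.ext ?_ ?_)
  · simp only [H, hist, h.1]
  · funext s
    exact info_eq (h.mono (Nat.succ_le_of_lt s.2)) i

theorem moveProb_eq {ω ω' : G.Outcome} {t : Fin T} (h : Agree (t + 1) ω ω') (g : G.Profile)
    (i : ι) : moveProb g t i ω = moveProb g t i ω' := by
  unfold moveProb; rw [(h.mono (Nat.le_succ _)).H_eq, h.action_eq]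

theorem noiseProb_eq {ω ω' : G.Outcome} {t : Fin T} (h : Agree (t + 1) ω ω') :
    noiseProb t ω = noiseProb t ω' := by
  unfold noiseProb; rw [h.2 t (Nat.lt_succ_self _)]

end Agree

/-! ### Factorization of outcome probabilities and continuations -/

/-- The times before `n`. -/
abbrev timesBefore (T n : ℕ) : Finset (Fin T) := Finset.univ.filter fun s => (s : ℕ) < n

/-- The times from `n` on. -/
abbrev timesFrom (T n : ℕ) : Finset (Fin T) := Finset.univ.filter fun s => n ≤ (s : ℕ)

/-- The probability of all moves at time `t`. -/
def stepProb (g : G.Profile) (t : Fin T) (ω : G.Outcome) : ℝ :=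
  (∏ i, moveProb g t i ω) * noiseProb t ω

theorem Agree.stepProb_eq {ω ω' : G.Outcome} {t : Fin T} (h : Agree (t + 1) ω ω')
    (g : G.Profile) : stepProb g t ω = stepProb g t ω' := by
  unfold stepProb; rw [h.noiseProb_eq]; congr 1
  exact Finset.prod_congr rfl fun i _ => h.moveProb_eq g i

theorem prob_eq_mul (g : G.Profile) (n : ℕ) (ω : G.Outcome) :
    prob g ω = (G.initLaw.1 ω.1.1 * ∏ s ∈ timesBefore T n, stepProb g s ω) *
      ∏ s ∈ timesFrom T n, stepProb g s ω := by
  rw [mul_assoc]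
  unfold prob
  congr 1
  rw [← Finset.prod_filter_mul_prod_filter_not Finset.univ (fun s : Fin T => (s : ℕ) < n)]
  simp only [not_lt]
  rfl

/-- The outcome in which the moves at time `t` are replaced by `b`. -/
def replaceAt (ω : G.Outcome) (t : Fin T) (b : (∀ i, G.U t i) × G.Noise t) : G.Outcome :=
  (ω.1, Function.update ω.2 t b)

theorem agree_replaceAt (ω : G.Outcome) (t : Fin T) (b : (∀ i, G.U t i) × G.Noise t) :
    Agree t (replaceAt ω t b) ω :=
  ⟨rfl, fun s hs => Function.update_of_ne (fun h => by simp [h] at hs) _ _⟩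

theorem sum_noise (t : Fin T) : ∑ w : G.Noise t, (G.noiseLaw t).1 w.1 = 1 := by
  rw [← (G.noiseLaw t).2.2,
    ← Finset.sum_filter_of_ne (p := fun w => 0 < (G.noiseLaw t).1 w)
      fun w _ hw => lt_of_le_of_ne ((G.noiseLaw t).2.1 w) (Ne.symm hw)]
  exact (Finset.sum_subtype _ (by simp) _).symm

/-- The histories at time `t` do not depend on the moves at time `t`, so the sum factorizes over the
players and nature. -/
theorem sum_stepProb (g : G.Profile) (t : Fin T) (ω : G.Outcome) :
    ∑ b : (∀ i, G.U t i) × G.Noise t, stepProb g t (replaceAt ω t b) = 1 := by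
  have h1 : ∀ b, stepProb g t (replaceAt ω t b) =
      (∏ i, (g i t (G.H t i ω)).1 (b.1 i)) * (G.noiseLaw t).1 b.2.1 := by
    intro b
    unfold stepProb moveProb noiseProb action
    simp only [(agree_replaceAt ω t b).H_eq]
    simp only [replaceAt, Function.update_self]
  simp only [h1, Fintype.sum_prod_type, ← Finset.mul_sum, sum_noise, mul_one]
  rw [← Fintype.prod_sum (fun i a => (g i t (G.H t i ω)).1 a)]
  exact Finset.prod_eq_one fun i _ => (g i t _).2.2

/-- The probabilities of the continuations from time `n` on sum to one. -/
theorem sum_continuation (g : G.Profile) (k : ℕ) : ∀ (n : ℕ), n + k = T → ∀ ω₀ : G.Outcome,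
    ∑ ω with Agree n ω ω₀, ∏ s ∈ timesFrom T n, stepProb g s ω = 1 := by
  induction k with
  | zero =>
    intro n hn ω₀
    have h1 : (Finset.univ.filter fun ω : G.Outcome => Agree n ω ω₀) = {ω₀} := by
      ext ω
      simp only [Finset.mem_filter, Finset.mem_univ, true_and, Finset.mem_singleton]
      refine ⟨fun h => Prod.ext h.1 (funext fun s => h.2 s (by have := s.2; omega)), ?_⟩
      rintro rfl; exact Agree.refl _ _
    rw [h1, Finset.sum_singleton]
    refine Finset.prod_eq_one fun s hs => absurd (Finset.mem_filter.1 hs).2 ?_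
    have := s.2
    omega
  | succ k ih =>
    intro n hn ω₀
    set t : Fin T := ⟨n, by omega⟩
    -- Split by the moves `b` at time `n`. Each fibre is an `Agree (n + 1)` class, to which the
    -- induction hypothesis applies.
    rw [← Finset.sum_fiberwise _ (fun ω : G.Outcome => ω.2 t), ← sum_stepProb g t ω₀]
    refine Finset.sum_congr rfl fun b _ => ?_
    have hset : ((Finset.univ.filter fun ω : G.Outcome => Agree n ω ω₀).filter
        fun ω => ω.2 t = b) =
        Finset.univ.filter fun ω => Agree (n + 1) ω (replaceAt ω₀ t b) := by
      ext ω
      simp only [Finset.mem_filter, Finset.mem_univ, true_and]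
      constructor
      · rintro ⟨h, hb⟩
        refine ⟨h.1, fun s hs => ?_⟩
        rcases Nat.lt_succ_iff_lt_or_eq.1 hs with hs | hs
        · exact (h.2 s hs).trans ((agree_replaceAt ω₀ t b).2 s hs).symm
        · obtain rfl : s = t := Fin.ext hs
          simp only [replaceAt, Function.update_self, hb]
      · intro h
        refine ⟨(h.mono (Nat.le_succ n)).trans (agree_replaceAt ω₀ t b), ?_⟩
        rw [h.2 t (Nat.lt_succ_self n)]
        simp only [replaceAt, Function.update_self]
    rw [hset, ← mul_one (stepProb g t _), ← ih (n + 1) (by omega) (replaceAt ω₀ t b),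
      Finset.mul_sum]
    refine Finset.sum_congr rfl fun ω hω => ?_
    rw [Finset.mem_filter] at hω
    rw [← hω.2.stepProb_eq (t := t) g, show timesFrom T n =
      insert t (timesFrom T (n + 1)) by
        ext s; simp only [Finset.mem_filter, Finset.mem_univ, true_and, Finset.mem_insert,
          Fin.ext_iff, t]; omega,
      Finset.prod_insert (by simp [t])]

/-- Outcomes weighted by their continuation probabilities from time `n` on: the sum of a function
of the moves before `n` does not depend on the profile. -/
theorem sum_mul_continuation_congr (g g' : G.Profile) {n : ℕ} (hn : n ≤ T)
    (F : G.Outcome → ℝ) (hF : ∀ ω ω', Agree n ω ω' → F ω = F ω') :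
    ∑ ω, F ω * ∏ s ∈ timesFrom T n, stepProb g s ω =
      ∑ ω, F ω * ∏ s ∈ timesFrom T n, stepProb g' s ω := by
  let r : Setoid G.Outcome := ⟨Agree n, Agree.refl n, Agree.symm, Agree.trans⟩
  rw [← Finset.sum_fiberwise _ (fun ω : G.Outcome => (⟦ω⟧ : Quotient r)),
    ← Finset.sum_fiberwise _ (fun ω : G.Outcome => (⟦ω⟧ : Quotient r))]
  refine Finset.sum_congr rfl fun q _ => ?_
  induction q using Quotient.inductionOn with | _ ω₀ => ?_
  have hset : (Finset.univ.filter fun ω : G.Outcome => (⟦ω⟧ : Quotient r) = ⟦ω₀⟧) =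
      Finset.univ.filter fun ω => Agree n ω ω₀ := by
    ext ω; simp only [Finset.mem_filter, Finset.mem_univ, true_and]; exact Quotient.eq
  have key : ∀ g : G.Profile, ∑ ω with Agree n ω ω₀,
      F ω * ∏ s ∈ timesFrom T n, stepProb g s ω = F ω₀ := by
    intro g
    rw [← mul_one (F ω₀), ← sum_continuation g (T - n) n (by omega) ω₀, Finset.mul_sum]
    exact Finset.sum_congr rfl fun ω hω => by rw [hF ω ω₀ (Finset.mem_filter.1 hω).2]
  rw [hset, key, key]

/-- Given the moves before `n`, the later ones have total probability one under any profile. So a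
function of the earlier moves sees only the strategies before `n`. -/
theorem sum_prob_congr {g g' : G.Profile} {n : ℕ} (hn : n ≤ T)
    (hg : ∀ i (t : Fin T), (t : ℕ) < n → g i t = g' i t)
    (F : G.Outcome → ℝ) (hF : ∀ ω ω', Agree n ω ω' → F ω = F ω') :
    ∑ ω, prob g ω * F ω = ∑ ω, prob g' ω * F ω := by
  have hstep : ∀ ω, ∏ s ∈ timesBefore T n, stepProb g s ω =
      ∏ s ∈ timesBefore T n, stepProb g' s ω := fun ω =>
    Finset.prod_congr rfl fun s hs => by
      unfold stepProb moveProb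
      simp only [hg _ s (Finset.mem_filter.1 hs).2]
  have := sum_mul_continuation_congr g g' hn
    (fun ω => F ω * (G.initLaw.1 ω.1.1 * ∏ s ∈ timesBefore T n, stepProb g' s ω)) ?_
  · simp only [prob_eq_mul _ n, hstep]
    convert this using 2 with ω _ ω _ <;> ring
  · intro ω ω' h
    rw [hF ω ω' h, h.1]
    congr 2
    exact Finset.prod_congr rfl fun s hs =>
      (h.mono (Nat.succ_le_of_lt (Finset.mem_filter.1 hs).2)).stepProb_eq g'

/-! ### Sums over events -/

/-- `Pr^g(A) E^g[F | A]`. -/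
def wsum (g : G.Profile) (F : G.Outcome → ℝ) (A : Set G.Outcome) : ℝ :=
  ∑ ω with ω ∈ A, prob g ω * F ω

theorem condE_eq (g : G.Profile) (F : G.Outcome → ℝ) (A : Set G.Outcome) :
    condE g F A = wsum g F A / pr g A := rfl

theorem wsum_eq_sum_ite (g : G.Profile) (F : G.Outcome → ℝ) (A : Set G.Outcome) :
    wsum g F A = ∑ ω, prob g ω * if ω ∈ A then F ω else 0 := by
  simp only [wsum, Finset.sum_filter, mul_ite, mul_zero]

theorem pr_eq_wsum (g : G.Profile) (A : Set G.Outcome) : pr g A = wsum g (fun _ => 1) A := by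
  simp only [wsum, pr, mul_one]

theorem pr_inter_eq_wsum (g : G.Profile) (A B : Set G.Outcome) :
    pr g (B ∩ A) = wsum g (fun ω => if ω ∈ B then 1 else 0) A := by
  simp only [wsum, pr, Finset.sum_filter, mul_ite, mul_one, mul_zero, Set.mem_inter_iff, ite_and]
  refine Finset.sum_congr rfl fun ω _ => ?_
  split_ifs <;> rfl

theorem condPr_eq_condE (g : G.Profile) (A B : Set G.Outcome) :
    condPr g B A = condE g (fun ω => if ω ∈ B then 1 else 0) A := by
  rw [condE_eq, condPr, pr_inter_eq_wsum]

theorem wsum_add (g : G.Profile) (F F' : G.Outcome → ℝ) (A : Set G.Outcome) :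
    wsum g (fun ω => F ω + F' ω) A = wsum g F A + wsum g F' A := by
  simp only [wsum, mul_add, Finset.sum_add_distrib]

theorem wsum_fiberwise {κ : Type*} [Fintype κ] (g : G.Profile) (F : G.Outcome → ℝ)
    (A : Set G.Outcome) (φ : G.Outcome → κ) :
    wsum g F A = ∑ k, wsum g F (A ∩ {ω | φ ω = k}) := by
  unfold wsum
  rw [← Finset.sum_fiberwise _ φ]
  refine Finset.sum_congr rfl fun k _ => Finset.sum_congr ?_ fun _ _ => rfl
  ext ω; simp

theorem prob_nonneg (g : G.Profile) (ω : G.Outcome) : 0 ≤ prob g ω :=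
  mul_nonneg (G.initLaw.2.1 _) <| Finset.prod_nonneg fun t _ =>
    mul_nonneg (Finset.prod_nonneg fun i _ => (g i t _).2.1 _) ((G.noiseLaw t).2.1 _)

theorem pr_nonneg (g : G.Profile) (A : Set G.Outcome) : 0 ≤ pr g A :=
  Finset.sum_nonneg fun ω _ => prob_nonneg g ω

/-- Lets identities in the product form `wsum = pr * c` hold for null events as well, which spares
case distinctions in the backward induction. -/
theorem wsum_eq_zero {g : G.Profile} {A : Set G.Outcome} (h : pr g A = 0)
    (F : G.Outcome → ℝ) : wsum g F A = 0 := by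
  unfold pr at h
  rw [Finset.sum_eq_zero_iff_of_nonneg fun ω _ => prob_nonneg g ω] at h
  exact Finset.sum_eq_zero fun ω hω => by rw [h ω hω, zero_mul]

theorem FullyMixed.prob_pos {g : G.Profile} (hg : FullyMixed g) (ω : G.Outcome) : 0 < prob g ω :=
  mul_pos ω.1.2 <| Finset.prod_pos fun t _ =>
    mul_pos (Finset.prod_pos fun i _ => hg i t _ _) (ω.2 t).2.2

theorem FullyMixed.pr_pos {g : G.Profile} (hg : FullyMixed g) {A : Set G.Outcome}
    (hA : A.Nonempty) : 0 < pr g A := by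
  obtain ⟨ω, hω⟩ := hA
  exact Finset.sum_pos (fun ω _ => hg.prob_pos ω) ⟨ω, by simpa using hω⟩

theorem evH_nonempty {t : Fin T} {i : ι} (h : G.Hist t i) : (evH h).Nonempty := by
  obtain ⟨_, ω, rfl⟩ := h
  exact ⟨ω, rfl⟩

/-- Changing the moves at time `t` leaves the history at `t` intact, so any action can follow any
history. -/
theorem evHU_nonempty {t : Fin T} {i : ι} (h : G.Hist t i) (a : G.U t i) :
    (evHU h a).Nonempty := by
  obtain ⟨ω, hω⟩ := evH_nonempty h
  refine ⟨replaceAt ω t (Function.update (ω.2 t).1 i a, (ω.2 t).2), ?_, ?_⟩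
  · rw [(agree_replaceAt ω t _).H_eq]; exact hω
  · simp [action, replaceAt]

/-- No positivity of `pr g A` is required: a quotient by zero is zero. -/
theorem abs_condE_le {g : G.Profile} {F : G.Outcome → ℝ} {A : Set G.Outcome} {c : ℝ}
    (hc : 0 ≤ c) (hF : ∀ ω, |F ω| ≤ c) : |condE g F A| ≤ c := by
  rw [condE_eq, abs_div, abs_of_nonneg (pr_nonneg g A)]
  refine div_le_of_le_mul₀ (pr_nonneg g A) hc ?_
  unfold wsum pr
  rw [Finset.mul_sum]
  refine (Finset.abs_sum_le_sum_abs _ _).trans (Finset.sum_le_sum fun ω _ => ?_)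
  rw [abs_mul, abs_of_nonneg (prob_nonneg g ω), mul_comm]
  exact mul_le_mul_of_nonneg_right (hF ω) (prob_nonneg g ω)

theorem abs_reward_le (t : Fin T) (i : ι) (ω : G.Outcome) : |G.reward t i ω| ≤ 1 :=
  abs_le.2 (G.reward_mem t _ _ _ i)

theorem abs_sum_reward_le (s : Finset (Fin T)) (i : ι) (ω : G.Outcome) :
    |∑ t ∈ s, G.reward t i ω| ≤ T := by
  refine (Finset.abs_sum_le_sum_abs _ _).trans ?_
  refine (Finset.sum_le_sum fun t _ => abs_reward_le t i ω).trans ?_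
  simpa using Finset.card_le_univ s

/-! ### Perfect recall -/

theorem H_eq_of_le {s t : Fin T} (hst : s ≤ t) {i : ι} {ω ω' : G.Outcome}
    (h : G.H t i ω = G.H t i ω') : G.H s i ω = G.H s i ω' := by
  have h' : G.hist t i ω = G.hist t i ω' := congrArg Subtype.val h
  exact Subtype.ext (congrArg (RawHist.restrict hst) h')

theorem info_eq_of_lt {s t : Fin T} (hst : s < t) {i : ι} {ω ω' : G.Outcome}
    (h : G.H t i ω = G.H t i ω') : G.info s i ω = G.info s i ω' := by
  have h' : G.hist t i ω = G.hist t i ω' := congrArg Subtype.val h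
  exact congrFun (congrArg Prod.snd h') ⟨s, hst⟩

theorem action_eq_of_info_eq {s : Fin T} {i : ι} {ω ω' : G.Outcome}
    (h : G.info s i ω = G.info s i ω') : G.action s i ω = G.action s i ω' := by
  obtain ⟨act, hact⟩ := G.action_recall s i
  have key : ∀ ω, G.action s i ω = act (G.info s i ω) := fun ω => (hact _ _ _).symm
  rw [key, key, h]

/-! ### Changing the profile -/

theorem wsum_congr {g g' : G.Profile} {n : ℕ} (hn : n ≤ T)
    (hg : ∀ i (t : Fin T), (t : ℕ) < n → g i t = g' i t) {F : G.Outcome → ℝ} {A : Set G.Outcome}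
    (hF : ∀ ω ω', Agree n ω ω' → F ω = F ω') (hA : ∀ ω ω', Agree n ω ω' → (ω ∈ A ↔ ω' ∈ A)) :
    wsum g F A = wsum g' F A := by
  rw [wsum_eq_sum_ite, wsum_eq_sum_ite]
  refine sum_prob_congr hn hg _ fun ω ω' h => ?_
  rw [hF ω ω' h]
  simp only [hA ω ω' h]

theorem Agree.mem_evH_iff {t : Fin T} {i : ι} (h : G.Hist t i) (ω ω' : G.Outcome)
    (hω : Agree t ω ω') : ω ∈ evH h ↔ ω' ∈ evH h := by
  simp only [evH, Set.mem_ofPred_eq, hω.H_eq]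

theorem Agree.mem_evHU_iff {t : Fin T} {i : ι} (h : G.Hist t i) (a : G.U t i) (ω ω' : G.Outcome)
    (hω : Agree (t + 1) ω ω') : ω ∈ evHU h a ↔ ω' ∈ evHU h a := by
  simp only [evHU, Set.mem_ofPred_eq, (hω.mono (Nat.le_succ _)).H_eq, hω.action_eq]

/-- Follow `σ` before time `n` and `σ'` from then on. -/
def switch {i : ι} (n : ℕ) (σ σ' : G.Strategy i) : G.Strategy i :=
  fun s => if (s : ℕ) < n then σ s else σ' s

theorem switch_of_lt {i : ι} {n : ℕ} (σ σ' : G.Strategy i) {s : Fin T} (hs : (s : ℕ) < n) :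
    switch n σ σ' s = σ s := if_pos hs

theorem switch_of_le {i : ι} {n : ℕ} (σ σ' : G.Strategy i) {s : Fin T} (hs : n ≤ (s : ℕ)) :
    switch n σ σ' s = σ' s := if_neg hs.not_gt

theorem deviate_congr (g : G.Profile) (i : ι) {σ σ' : G.Strategy i} {t : Fin T}
    (h : σ t = σ' t) (j : ι) : deviate g i σ j t = deviate g i σ' j t := by
  rcases eq_or_ne j i with rfl | hj
  · simpa [deviate] using h
  · simp [deviate, hj]

theorem deviate_self (g : G.Profile) (i : ι) : deviate g i (g i) = g :=
  Function.update_eq_self i g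

theorem deviate_eq_of_eq (g : G.Profile) (i : ι) {σ : G.Strategy i} {t : Fin T}
    (h : σ t = g i t) (j : ι) : deviate g i σ j t = g j t := by
  rw [deviate_congr g i h, deviate_self]

/-- Only the factor of player `i` changes. The cross-multiplied form avoids dividing by a move
probability that may vanish. -/
theorem stepProb_deviate (g : G.Profile) (i : ι) (σ : G.Strategy i) (s : Fin T) (ω : G.Outcome) :
    stepProb (deviate g i σ) s ω * (g i s (G.H s i ω)).1 (G.action s i ω) =
      (σ s (G.H s i ω)).1 (G.action s i ω) * stepProb g s ω := by
  unfold stepProb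
  rw [← Finset.mul_prod_erase Finset.univ (fun j => moveProb g s j ω) (Finset.mem_univ i),
    ← Finset.mul_prod_erase Finset.univ (fun j => moveProb (deviate g i σ) s j ω)
      (Finset.mem_univ i)]
  have h1 : ∏ j ∈ Finset.univ.erase i, moveProb (deviate g i σ) s j ω =
      ∏ j ∈ Finset.univ.erase i, moveProb g s j ω :=
    Finset.prod_congr rfl fun j hj => by
      simp [moveProb, deviate, (Finset.mem_erase.1 hj).1]
  have h2 : moveProb (deviate g i σ) s i ω = (σ s (G.H s i ω)).1 (G.action s i ω) := by
    simp [moveProb, deviate]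
  rw [h1, h2, show moveProb g s i ω = (g i s (G.H s i ω)).1 (G.action s i ω) from rfl]
  ring

/-- The contribution of the moves of a player before time `n` to the probability of `ω`. -/
def ownProb {i : ι} (σ : G.Strategy i) (n : ℕ) (ω : G.Outcome) : ℝ :=
  ∏ s ∈ timesBefore T n, (σ s (G.H s i ω)).1 (G.action s i ω)

theorem prob_deviate_switch (g : G.Profile) (i : ι) (σ : G.Strategy i) (n : ℕ) (ω : G.Outcome) :
    prob (deviate g i (switch n σ (g i))) ω * ownProb (g i) n ω = ownProb σ n ω * prob g ω := by
  rw [prob_eq_mul _ n, prob_eq_mul g n]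
  have h1 : ∏ s ∈ timesFrom T n, stepProb (deviate g i (switch n σ (g i))) s ω =
      ∏ s ∈ timesFrom T n, stepProb g s ω :=
    Finset.prod_congr rfl fun s hs => by
      unfold stepProb moveProb
      simp only [deviate_eq_of_eq g i (switch_of_le σ (g i) (Finset.mem_filter.1 hs).2)]
  have h2 : (∏ s ∈ timesBefore T n, stepProb (deviate g i (switch n σ (g i))) s ω) *
      ownProb (g i) n ω = ownProb σ n ω * ∏ s ∈ timesBefore T n, stepProb g s ω := by
    unfold ownProb
    rw [← Finset.prod_mul_distrib, ← Finset.prod_mul_distrib]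
    exact Finset.prod_congr rfl fun s hs => by
      rw [stepProb_deviate, switch_of_lt σ (g i) (Finset.mem_filter.1 hs).2]
  rw [h1]
  linear_combination (G.initLaw.1 ω.1.1 * ∏ s ∈ timesFrom T n, stepProb g s ω) * h2

/-- This is how perfect recall enters: `h` determines all earlier own histories and, through the
recorded information, all earlier own actions, while `a` fixes the current one. -/
theorem ownProb_eq {t : Fin T} {i : ι} {h : G.Hist t i} {a : G.U t i} {ω ω' : G.Outcome}
    (hω : ω ∈ evHU h a) (hω' : ω' ∈ evHU h a) (σ : G.Strategy i) :
    ownProb σ (t + 1) ω = ownProb σ (t + 1) ω' := by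
  have hH : G.H t i ω = G.H t i ω' := hω.1.trans hω'.1.symm
  refine Finset.prod_congr rfl fun s hs => ?_
  have hst : s ≤ t := Nat.lt_succ_iff.1 (Finset.mem_filter.1 hs).2
  have ha : G.action s i ω = G.action s i ω' := by
    rcases hst.lt_or_eq with hst | rfl
    · exact action_eq_of_info_eq (info_eq_of_lt hst hH)
    · exact hω.2.trans hω'.2.symm
  rw [H_eq_of_le hst hH, ha]

theorem wsum_deviate (g : G.Profile) {t : Fin T} {i : ι} {h : G.Hist t i} {a : G.U t i}
    (σ : G.Strategy i) {F : G.Outcome → ℝ} (hF : ∀ ω ω', Agree (t + 1) ω ω' → F ω = F ω')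
    {ω₀ : G.Outcome} (hω₀ : ω₀ ∈ evHU h a) :
    wsum (deviate g i σ) F (evHU h a) * ownProb (g i) (t + 1) ω₀ =
      ownProb σ (t + 1) ω₀ * wsum g F (evHU h a) := by
  -- `F` and the event depend only on moves up to time `t`, so `σ` may be replaced by `g i`
  -- afterwards. Then only the own factors up to `t` differ.
  rw [wsum_congr (g' := deviate g i (switch (t + 1) σ (g i))) (Nat.succ_le_of_lt t.2)
    (fun j s hs => deviate_congr g i (switch_of_lt σ (g i) hs).symm j) hF
    (Agree.mem_evHU_iff h a)]
  unfold wsum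
  rw [Finset.sum_mul, Finset.mul_sum]
  refine Finset.sum_congr rfl fun ω hω => ?_
  have hω : ω ∈ evHU h a := (Finset.mem_filter.1 hω).2
  rw [ownProb_eq hω₀ hω, ownProb_eq hω₀ hω]
  linear_combination F ω * prob_deviate_switch g i σ (t + 1) ω

/-- By `wsum_deviate`, passing to `σ` multiplies numerator and denominator by the same constant, a
ratio of own move probabilities whose denominator is positive by full mixing. -/
theorem FullyMixed.condE_deviate {g : G.Profile} (hg : FullyMixed g) {t : Fin T} {i : ι}
    {h : G.Hist t i} {a : G.U t i} {F : G.Outcome → ℝ}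
    (hF : ∀ ω ω', Agree (t + 1) ω ω' → F ω = F ω') :
    IsPartialCondE g i F (evHU h a) (condE g F (evHU h a)) := by
  intro σ hσ
  obtain ⟨ω₀, hω₀⟩ := evHU_nonempty h a
  have hpos : 0 < ownProb (g i) (t + 1) ω₀ := Finset.prod_pos fun s _ => hg i s _ _
  have hprg := (hg.pr_pos (evHU_nonempty h a)).ne'
  have h1 := wsum_deviate g σ hF hω₀
  have h2 := wsum_deviate g σ (F := fun _ => 1) (fun _ _ _ => rfl) hω₀
  rw [← pr_eq_wsum, ← pr_eq_wsum] at h2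
  rw [condE_eq, condE_eq, div_eq_div_iff hσ hprg]
  refine mul_right_cancel₀ hpos.ne' ?_
  linear_combination pr g (evHU h a) * h1 - wsum g F (evHU h a) * h2

theorem FullyMixed.condPr_deviate {g : G.Profile} (hg : FullyMixed g) {t : Fin T} {i : ι}
    {h : G.Hist t i} {a : G.U t i} (z : G.Z t i) :
    IsPartialCondPr g i {ω | G.info t i ω = z} (evHU h a)
      (condPr g {ω | G.info t i ω = z} (evHU h a)) := by
  intro σ hσ
  rw [condPr_eq_condE, condPr_eq_condE]
  refine hg.condE_deviate (fun ω ω' hω => ?_) σ hσ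
  simp only [Set.mem_ofPred_eq, hω.info_eq]

/-- Compare `g` with the deviation `σ` that plays `a` for sure at time `t`. It leaves the law of the
history at `t` unchanged, and on outcomes with action `a` its probability times `g i t h a` is that
of `g`. -/
theorem pr_evHU (g : G.Profile) {t : Fin T} {i : ι} (h : G.Hist t i) (a : G.U t i) :
    pr g (evHU h a) = pr g (evH h) * (g i t h).1 a := by
  let σ : G.Strategy i := fun s => if hs : s = t then fun _ =>
    ⟨Pi.single (hs ▸ a) 1, single_mem_stdSimplex ℝ _⟩ else g i s
  have hσ : ∀ h' : G.Hist t i, (σ t h').1 = Pi.single a 1 := fun h' => by simp [σ]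
  have hσ' : ∀ s ≠ t, σ s = g i s := fun s hs => by simp [σ, hs]
  have h0 : wsum g (fun _ => 1) (evH h) = wsum (deviate g i σ) (fun _ => 1) (evH h) :=
    wsum_congr t.2.le
      (fun j s hs => (deviate_eq_of_eq g i (hσ' s (by rintro rfl; simp at hs)) j).symm)
      (fun _ _ _ => rfl) (Agree.mem_evH_iff h)
  rw [pr_eq_wsum, pr_eq_wsum, h0, wsum_eq_sum_ite, wsum_eq_sum_ite, Finset.sum_mul]
  refine Finset.sum_congr rfl fun ω _ => ?_
  have hs : prob (deviate g i σ) ω * (g i t (G.H t i ω)).1 (G.action t i ω) =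
      (σ t (G.H t i ω)).1 (G.action t i ω) * prob g ω := by
    have e : ∀ g : G.Profile, prob g ω = (G.initLaw.1 ω.1.1 *
      ∏ s ∈ Finset.univ.erase t, stepProb g s ω) * stepProb g t ω := by
      intro g
      rw [mul_assoc, Finset.prod_erase_mul _ _ (Finset.mem_univ t)]; rfl
    rw [e, e, mul_assoc, stepProb_deviate, Finset.prod_congr rfl fun s hs => by
      rw [show stepProb (deviate g i σ) s ω = stepProb g s ω by
        unfold stepProb moveProb
        simp only [deviate_eq_of_eq g i (hσ' s (Finset.mem_erase.1 hs).1)]]]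
    ring
  rw [hσ] at hs
  by_cases hH : G.H t i ω = h
  · subst hH
    by_cases ha : G.action t i ω = a
    · subst ha
      simp only [Pi.single_eq_same] at hs
      simp [evH, evHU, hs]
    · have hz : stepProb (deviate g i σ) t ω = 0 := by
        unfold stepProb
        rw [Finset.prod_eq_zero (Finset.mem_univ i), zero_mul]
        simp [moveProb, deviate, hσ, ha]
      have : prob (deviate g i σ) ω = 0 := by
        unfold prob
        rw [Finset.prod_eq_zero (Finset.mem_univ t) hz, mul_zero]
      simp [evH, evHU, ha, this]
  · simp [evH, evHU, hH]

/-! ### Backward induction in a model -/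

theorem backward_induction {p : Fin T → Prop}
    (step : ∀ t : Fin T, (∀ hs : (t : ℕ) + 1 < T, p ⟨t + 1, hs⟩) → p t) (t : Fin T) : p t := by
  obtain ⟨k, hk⟩ : ∃ k, (t : ℕ) + k + 1 = T := ⟨T - t - 1, by have := t.2; omega⟩
  induction k generalizing t with
  | zero => exact step t fun hs => absurd hs (by omega)
  | succ k ih => exact step t fun hs => ih ⟨t + 1, hs⟩ (by simp only; omega)

/-- The part of the history-action value in a model that accrues after time `t`. -/
def tailValue {i : ι} (P : G.Kernels) (r : G.Rewards) (σ : G.Strategy i) (t : Fin T)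
    (h : G.Hist t i) (a : G.U t i) : ℝ :=
  if hs : (t : ℕ) + 1 < T then
    ∑ k : G.Hist ⟨t + 1, hs⟩ i with
        RawHist.restrict (Fin.mk_le_mk.2 (Nat.le_succ t)) k.1 = h.1,
      rewardToGo P r σ (t + 1) hs k *
        (P i ⟨t, hs⟩ h a).1 (k.1.2 ⟨t, Fin.mk_lt_mk.2 (Nat.lt_succ_self t)⟩)
  else 0

/-- The value in a model of the action `a` at the history `h`, when `σ` is followed afterwards. -/
def actionValue {i : ι} (P : G.Kernels) (r : G.Rewards) (σ : G.Strategy i) (t : Fin T)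
    (h : G.Hist t i) (a : G.U t i) : ℝ :=
  (r i t h a : ℝ) + tailValue P r σ t h a

theorem rewardToGo_eq {i : ι} (P : G.Kernels) (r : G.Rewards) (σ : G.Strategy i) (t : Fin T)
    (h : G.Hist t i) :
    rewardToGo P r σ t t.2 h = ∑ a, actionValue P r σ t h a * (σ t h).1 a := by
  rw [rewardToGo]; rfl

theorem tailValue_le {i : ι} {P : G.Kernels} {r : G.Rewards} {σ σ' : G.Strategy i} {t : Fin T}
    (hle : ∀ (hs : (t : ℕ) + 1 < T) k, rewardToGo P r σ (t + 1) hs k ≤ rewardToGo P r σ' (t + 1) hs k)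
    (h : G.Hist t i) (a : G.U t i) : tailValue P r σ t h a ≤ tailValue P r σ' t h a := by
  unfold tailValue
  split_ifs with hs
  · exact Finset.sum_le_sum fun k _ => mul_le_mul_of_nonneg_right (hle hs k) ((P i ⟨t, hs⟩ h a).2.1 _)
  · exact le_rfl

theorem actionValue_le {i : ι} {P : G.Kernels} {r : G.Rewards} {σ σ' : G.Strategy i} {t : Fin T}
    (hle : ∀ (hs : (t : ℕ) + 1 < T) k, rewardToGo P r σ (t + 1) hs k ≤ rewardToGo P r σ' (t + 1) hs k)
    (h : G.Hist t i) (a : G.U t i) : actionValue P r σ t h a ≤ actionValue P r σ' t h a :=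
  add_le_add le_rfl (tailValue_le hle h a)

theorem rewardToGo_congr {i : ι} (P : G.Kernels) (r : G.Rewards) {σ σ' : G.Strategy i}
    (t : Fin T) (hσ : ∀ s, t ≤ s → σ s = σ' s) (h : G.Hist t i) :
    rewardToGo P r σ t t.2 h = rewardToGo P r σ' t t.2 h := by
  induction t using backward_induction with
  | step t ih =>
  have ih' : ∀ (hs : (t : ℕ) + 1 < T) k,
      rewardToGo P r σ (t + 1) hs k = rewardToGo P r σ' (t + 1) hs k := fun hs k =>
    ih hs (fun s hs' => hσ s ((Fin.mk_le_mk.2 (Nat.le_succ t)).trans hs')) k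
  rw [rewardToGo_eq, rewardToGo_eq]
  refine Finset.sum_congr rfl fun a _ => ?_
  -- Equality of action values comes from applying monotonicity in the continuation both ways.
  rw [hσ t le_rfl, le_antisymm (actionValue_le (fun hs k => (ih' hs k).le) h a)
    (actionValue_le (fun hs k => (ih' hs k).ge) h a)]

theorem tailValue_congr {i : ι} (P : G.Kernels) (r : G.Rewards) {σ σ' : G.Strategy i}
    (t : Fin T) (hσ : ∀ s, t < s → σ s = σ' s) (h : G.Hist t i) (a : G.U t i) :
    tailValue P r σ t h a = tailValue P r σ' t h a := by
  have key : ∀ (hs : (t : ℕ) + 1 < T) k,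
      rewardToGo P r σ (t + 1) hs k = rewardToGo P r σ' (t + 1) hs k := fun hs k =>
    rewardToGo_congr P r ⟨t + 1, hs⟩
      (fun s hs' => hσ s ((Fin.mk_lt_mk.2 (Nat.lt_succ_self t)).trans_le hs')) k
  exact le_antisymm (tailValue_le (fun hs k => (key hs k).le) h a)
    (tailValue_le (fun hs k => (key hs k).ge) h a)

theorem sum_mul_le_of_le {α : Type*} [Fintype α] {q : α → ℝ} {p : α → ℝ}
    (hp : p ∈ stdSimplex ℝ α) {c : ℝ} (hc : ∀ a, q a ≤ c) : ∑ a, q a * p a ≤ c := by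
  calc ∑ a, q a * p a ≤ ∑ a, c * p a :=
        Finset.sum_le_sum fun a _ => mul_le_mul_of_nonneg_right (hc a) (hp.1 a)
    _ = c := by rw [← Finset.mul_sum, hp.2, mul_one]

theorem le_sum_mul_of_le {α : Type*} [Fintype α] {q : α → ℝ} {p : α → ℝ}
    (hp : p ∈ stdSimplex ℝ α) {c : ℝ} (hc : ∀ a, p a ≠ 0 → c ≤ q a) : c ≤ ∑ a, q a * p a := by
  calc c = ∑ a, c * p a := by rw [← Finset.mul_sum, hp.2, mul_one]
    _ ≤ ∑ a, q a * p a := Finset.sum_le_sum fun a _ => by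
        by_cases ha : p a = 0
        · simp [ha]
        · exact mul_le_mul_of_nonneg_right (hc a ha) (hp.1 a)

/-- A point of the simplex that averages `q` to at least all its values is supported on the
maximizers of `q`. -/
theorem support_subset_argmax {α : Type*} [Fintype α] {q : α → ℝ} {p : α → ℝ}
    (hp : p ∈ stdSimplex ℝ α) (hc : ∀ b, q b ≤ ∑ a, q a * p a) {a : α} (ha : p a ≠ 0) (b : α) :
    q b ≤ q a := by
  set c := ∑ a, q a * p a with hcdef
  have h0 : ∑ a, (c - q a) * p a = 0 := by
    simp only [sub_mul, Finset.sum_sub_distrib, ← Finset.mul_sum, hp.2, mul_one, ← hcdef, sub_self]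
  rw [Finset.sum_eq_zero_iff_of_nonneg fun a _ => mul_nonneg (sub_nonneg.2 (hc a)) (hp.1 a)] at h0
  have h1 : c - q a = 0 := (mul_eq_zero.1 (h0 a (Finset.mem_univ a))).resolve_right ha
  linarith [hc b]

/-- A strategy is optimal if it only takes actions that maximize its own action values. -/
theorem rewardToGo_le_of_argmax {i : ι} {P : G.Kernels} {r : G.Rewards} {σ : G.Strategy i}
    (hσ : ∀ t h a, (σ t h).1 a ≠ 0 → ∀ b, actionValue P r σ t h b ≤ actionValue P r σ t h a)
    (σ' : G.Strategy i) (t : Fin T) (h : G.Hist t i) :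
    rewardToGo P r σ' t t.2 h ≤ rewardToGo P r σ t t.2 h := by
  induction t using backward_induction with
  | step t ih =>
  rw [rewardToGo_eq, rewardToGo_eq]
  exact sum_mul_le_of_le (σ' t h).2 fun b => (actionValue_le ih h b).trans
    (le_sum_mul_of_le (σ t h).2 fun a ha => hσ t h a ha b)

/-- One-shot deviations: an optimal strategy only takes actions of maximal value. -/
theorem actionValue_le_of_optimal {i : ι} {P : G.Kernels} {r : G.Rewards} {σ : G.Strategy i}
    {t : Fin T} {h : G.Hist t i}
    (hσ : ∀ σ' : G.Strategy i, rewardToGo P r σ' t t.2 h ≤ rewardToGo P r σ t t.2 h)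
    {a : G.U t i} (ha : (σ t h).1 a ≠ 0) (b : G.U t i) :
    actionValue P r σ t h b ≤ actionValue P r σ t h a := by
  refine support_subset_argmax (σ t h).2 (fun b => ?_) ha b
  rw [← rewardToGo_eq]
  refine le_trans (le_of_eq ?_)
    -- The one-shot deviation plays `b` at time `t` only. Its continuation is unchanged, so its
    -- reward-to-go is the action value of `b`.
    (hσ (Function.update σ t fun _ => ⟨Pi.single b 1, single_mem_stdSimplex ℝ b⟩))
  have hval : ∀ a, actionValue P r
      (Function.update σ t fun _ => ⟨Pi.single b 1, single_mem_stdSimplex ℝ b⟩) t h a =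
      actionValue P r σ t h a := fun a => congrArg _ <|
    tailValue_congr P r t (fun s hs => Function.update_of_ne hs.ne' _ _) h a
  rw [rewardToGo_eq]
  simp only [hval, Function.update_self]
  simp [Pi.single_apply]

/-- Dynamic programming: after stage `k` the strategy maximizes its own action values in the last
`k` periods. -/
theorem exists_optimal {i : ι} (P : G.Kernels) (r : G.Rewards) :
    ∃ σ : G.Strategy i, ∀ (σ' : G.Strategy i) (t : Fin T) (h : G.Hist t i),
      rewardToGo P r σ' t t.2 h ≤ rewardToGo P r σ t t.2 h := by
  suffices H : ∀ k : ℕ, ∃ σ : G.Strategy i, ∀ t : Fin T, T ≤ (t : ℕ) + k → ∀ h a,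
      (σ t h).1 a ≠ 0 → ∀ b, actionValue P r σ t h b ≤ actionValue P r σ t h a by
    obtain ⟨σ, hσ⟩ := H T
    exact ⟨σ, rewardToGo_le_of_argmax fun t => hσ t (Nat.le_add_left _ _)⟩
  intro k
  induction k with
  | zero =>
    refine ⟨fun t _ => ⟨Pi.single (Classical.arbitrary _) 1, single_mem_stdSimplex ℝ _⟩, ?_⟩
    intro t ht
    exact absurd t.2 (by omega)
  | succ k ih =>
    obtain ⟨σ, hσ⟩ := ih
    have hmax : ∀ (t : Fin T) (h : G.Hist t i), ∃ a, ∀ b,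
        actionValue P r σ t h b ≤ actionValue P r σ t h a := fun t h =>
      Finite.exists_max (actionValue P r σ t h)
    choose best hbest using hmax
    -- Only the choice at the latest of the overwritten times matters; earlier ones are overwritten
    -- again at later stages.
    let τ : G.Strategy i := fun t => if T ≤ (t : ℕ) + k then σ t else
      fun h => ⟨Pi.single (best t h) 1, single_mem_stdSimplex ℝ _⟩
    have hval : ∀ t : Fin T, T ≤ (t : ℕ) + (k + 1) → ∀ h a,
        actionValue P r τ t h a = actionValue P r σ t h a := fun t ht h a => congrArg _ <|
      tailValue_congr P r t (fun s hs => if_pos (by have : (t : ℕ) < s := hs; omega)) h a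
    refine ⟨τ, fun t ht h a ha b => ?_⟩
    rw [hval t ht, hval t ht]
    by_cases h' : T ≤ (t : ℕ) + k
    · exact hσ t h' h a (by simpa [τ, h'] using ha) b
    · have : a = best t h := by
        by_contra hne
        simp [τ, h', hne] at ha
      rw [this]; exact hbest t h b

/-- The one-shot deviation principle. It turns model rationality into the support condition of
model-free version 1. -/
theorem rationalUnderModel_iff (g : G.Profile) (P : G.Kernels) (r : G.Rewards) :
    RationalUnderModel g P r ↔ ∀ (i : ι) (t : Fin T) (h : G.Hist t i) (a : G.U t i),
      (g i t h).1 a ≠ 0 → ∀ b, actionValue P r (g i) t h b ≤ actionValue P r (g i) t h a :=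
  ⟨fun hg i t h _ ha b => actionValue_le_of_optimal (hg i t h) ha b,
    fun hg i t h σ => rewardToGo_le_of_argmax (hg i) σ t h⟩

/-- Rationality may be tested with the action values that go with an optimal continuation. -/
theorem rationalUnderModel_iff_of_optimal (g : G.Profile) (P : G.Kernels) (r : G.Rewards)
    (τ : G.Profile) (hτ : RationalUnderModel τ P r) :
    RationalUnderModel g P r ↔ ∀ (i : ι) (t : Fin T) (h : G.Hist t i) (a : G.U t i),
      (g i t h).1 a ≠ 0 → ∀ b, actionValue P r (τ i) t h b ≤ actionValue P r (τ i) t h a := by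
  have hval : ∀ (i : ι) (t : Fin T), (∀ (hs : (t : ℕ) + 1 < T) k,
      rewardToGo P r (τ i) (t + 1) hs k ≤ rewardToGo P r (g i) (t + 1) hs k) →
      ∀ h a, actionValue P r (g i) t h a = actionValue P r (τ i) t h a := fun i t ht h a =>
    le_antisymm (actionValue_le (fun hs k => hτ i ⟨t + 1, hs⟩ k (g i)) h a)
      (actionValue_le ht h a)
  constructor
  · intro hg i t h a ha b
    have hv := hval i t fun hs k => hg i ⟨t + 1, hs⟩ k (τ i)
    rw [← hv, ← hv]
    exact actionValue_le_of_optimal (hg i t h) ha b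
  · intro hg
    have key : ∀ (i : ι) (t : Fin T) (h : G.Hist t i),
        rewardToGo P r (τ i) t t.2 h ≤ rewardToGo P r (g i) t t.2 h := by
      intro i t
      induction t using backward_induction with
      | step t ih =>
      intro h
      rw [rewardToGo_eq, rewardToGo_eq]
      -- By the induction hypothesis `g` continues optimally, so its action values equal those of
      -- `τ`, and it plays only maximizers of these.
      refine sum_mul_le_of_le (τ i t h).2 fun b => le_sum_mul_of_le (g i t h).2 fun a ha => ?_
      rw [hval i t ih]
      exact hg i t h a ha b
    exact fun i t h σ => (hτ i t h σ).trans (key i t h)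

/-! ### Values in a consistent model -/

theorem H_succ_eq_iff {t : Fin T} {i : ι} (hs : (t : ℕ) + 1 < T) (k : G.Hist ⟨t + 1, hs⟩ i)
    (ω : G.Outcome) : G.H ⟨t + 1, hs⟩ i ω = k ↔
      (G.H t i ω).1 = RawHist.restrict (Fin.mk_le_mk.2 (Nat.le_succ t)) k.1 ∧
        G.info t i ω = k.1.2 ⟨t, Fin.mk_lt_mk.2 (Nat.lt_succ_self t)⟩ := by
  constructor
  · rintro rfl; exact ⟨rfl, rfl⟩
  · rintro ⟨h1, h2⟩
    refine Subtype.ext (Prod.ext ?_ ?_)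
    · have := congrArg Prod.fst h1; exact this
    · funext ⟨s, hst⟩
      rcases Nat.lt_succ_iff_lt_or_eq.1 (Fin.lt_def.1 hst) with hlt | heq
      · exact congrFun (congrArg Prod.snd h1) ⟨s, hlt⟩
      · obtain rfl : s = t := Fin.ext heq
        exact h2

/-- By perfect recall the next history `k` determines `h` and `a`, so the intersection is empty or
all of `evH k`. -/
theorem wsum_inter_H_succ (g : G.Profile) {t : Fin T} {i : ι} (hs : (t : ℕ) + 1 < T)
    (h : G.Hist t i) (a : G.U t i) (k : G.Hist ⟨t + 1, hs⟩ i) {F : G.Outcome → ℝ} {c : ℝ}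
    (hF : wsum g F (evH k) = pr g (evH k) * c) :
    wsum g F (evHU h a ∩ {ω | G.H ⟨t + 1, hs⟩ i ω = k}) =
      pr g (evHU h a ∩ {ω | G.H ⟨t + 1, hs⟩ i ω = k}) * c := by
  rcases (evHU h a ∩ {ω | G.H ⟨t + 1, hs⟩ i ω = k}).eq_empty_or_nonempty with he | ⟨ω₀, h1, h2⟩
  · rw [he]; simp [wsum, pr]
  · have htt : t < ⟨t + 1, hs⟩ := Fin.mk_lt_mk.2 (Nat.lt_succ_self t)
    have : evHU h a ∩ {ω | G.H ⟨t + 1, hs⟩ i ω = k} = evH k := by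
      refine Set.inter_eq_right.2 fun ω hω => ?_
      have hH : G.H ⟨t + 1, hs⟩ i ω = G.H ⟨t + 1, hs⟩ i ω₀ := Eq.trans hω (Eq.symm h2)
      exact ⟨(H_eq_of_le htt.le hH).trans h1.1,
        (action_eq_of_info_eq (info_eq_of_lt htt hH)).trans h1.2⟩
    rw [this, hF]

theorem pr_inter_eq_of_partial {g : G.Profile} {i : ι} {A B : Set G.Outcome} {c : ℝ}
    (hc : IsPartialCondPr g i B A c) (σ : G.Strategy i) :
    pr (deviate g i σ) (B ∩ A) = pr (deviate g i σ) A * c := by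
  by_cases h : pr (deviate g i σ) A = 0
  · rw [pr_inter_eq_wsum, wsum_eq_zero h, h, zero_mul]
  · rw [← hc σ h, condPr, mul_div_cancel₀ _ h]

theorem wsum_eq_of_partial {g : G.Profile} {i : ι} {A : Set G.Outcome} {F : G.Outcome → ℝ} {c : ℝ}
    (hc : IsPartialCondE g i F A c) (σ : G.Strategy i) :
    wsum (deviate g i σ) F A = pr (deviate g i σ) A * c := by
  by_cases h : pr (deviate g i σ) A = 0
  · rw [wsum_eq_zero h, h, zero_mul]
  · rw [← hc σ h, condE_eq, mul_div_cancel₀ _ h]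

/-- The Bellman step: split by the next history `k`, whose probability given `(h, a)` is supplied by
the kernel, and insert the known value at `k`. -/
theorem wsum_tail_of_succ {g : G.Profile} {P : G.Kernels} {r : G.Rewards}
    (hc : ModelConsistent g P r) {i : ι} (σ : G.Strategy i) (t : Fin T)
    (hJ : ∀ (hs : (t : ℕ) + 1 < T) (k : G.Hist ⟨t + 1, hs⟩ i),
      wsum (deviate g i σ) (fun ω => ∑ s ∈ Finset.Ici ⟨t + 1, hs⟩, G.reward s i ω) (evH k) =
        pr (deviate g i σ) (evH k) * rewardToGo P r σ (t + 1) hs k)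
    (h : G.Hist t i) (a : G.U t i) :
    wsum (deviate g i σ) (fun ω => ∑ s ∈ Finset.Ioi t, G.reward s i ω) (evHU h a) =
      pr (deviate g i σ) (evHU h a) * tailValue P r σ t h a := by
  unfold tailValue
  split_ifs with hs
  · have hI : Finset.Ioi t = Finset.Ici ⟨t + 1, hs⟩ := by
      ext s; simp only [Finset.mem_Ioi, Finset.mem_Ici, Fin.lt_def, Fin.le_def]; omega
    rw [hI, wsum_fiberwise _ _ _ (G.H ⟨t + 1, hs⟩ i), Finset.sum_filter, Finset.mul_sum]
    refine Finset.sum_congr rfl fun k _ => ?_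
    rw [wsum_inter_H_succ _ hs h a k (hJ hs k)]
    split_ifs with hk
    -- Since `k` extends `h`, reaching `k` from `(h, a)` is the same as learning the last component
    -- of `k`.
    · rw [mul_comm (rewardToGo P r σ (t + 1) hs k), ← mul_assoc,
        ← pr_inter_eq_of_partial ((hc i t h a).1 hs _) σ]
      congr 2
      ext ω
      exact ⟨fun ⟨h1, h2⟩ => ⟨((H_succ_eq_iff hs k ω).1 h2).2, h1⟩,
        fun ⟨h1, h2⟩ => ⟨h2, (H_succ_eq_iff hs k ω).2 ⟨by rw [h2.1, hk], h1⟩⟩⟩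
    · rw [mul_zero]
      refine mul_eq_zero_of_left ?_ _
      have he : evHU h a ∩ {ω | G.H ⟨t + 1, hs⟩ i ω = k} = ∅ :=
        Set.eq_empty_of_forall_notMem fun ω ⟨⟨h1, _⟩, h2⟩ =>
          hk (by rw [← ((H_succ_eq_iff hs k ω).1 h2).1, h1])
      rw [he]
      simp [pr]
  · have hI : Finset.Ioi t = ∅ := by
      ext s; simp only [Finset.mem_Ioi, Fin.lt_def, Finset.notMem_empty, iff_false]; omega
    simp [hI, wsum]

theorem wsum_action_of_tail {g : G.Profile} {P : G.Kernels} {r : G.Rewards}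
    (hc : ModelConsistent g P r) {i : ι} (σ : G.Strategy i) {t : Fin T} {h : G.Hist t i}
    {a : G.U t i}
    (htail : wsum (deviate g i σ) (fun ω => ∑ s ∈ Finset.Ioi t, G.reward s i ω) (evHU h a) =
      pr (deviate g i σ) (evHU h a) * tailValue P r σ t h a) :
    wsum (deviate g i σ) (fun ω => ∑ s ∈ Finset.Ici t, G.reward s i ω) (evHU h a) =
      pr (deviate g i σ) (evHU h a) * actionValue P r σ t h a := by
  have hsum : ∀ ω, ∑ s ∈ Finset.Ici t, G.reward s i ω =
      G.reward t i ω + ∑ s ∈ Finset.Ioi t, G.reward s i ω := fun ω => by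
    rw [← Finset.Ioi_insert, Finset.sum_insert Finset.notMem_Ioi_self]
  simp only [hsum]
  rw [wsum_add, htail, wsum_eq_of_partial (hc i t h a).2, actionValue, mul_add]

/-- A consistent model predicts the payoff of every own strategy against the others. The product
form also covers histories that `σ` does not reach. -/
theorem wsum_rewardToGo {g : G.Profile} {P : G.Kernels} {r : G.Rewards}
    (hc : ModelConsistent g P r) {i : ι} (σ : G.Strategy i) (t : Fin T) (h : G.Hist t i) :
    wsum (deviate g i σ) (fun ω => ∑ s ∈ Finset.Ici t, G.reward s i ω) (evH h) =
      pr (deviate g i σ) (evH h) * rewardToGo P r σ t t.2 h := by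
  induction t using backward_induction with
  | step t ih =>
  rw [wsum_fiberwise _ _ _ (G.action t i), rewardToGo_eq, Finset.mul_sum]
  refine Finset.sum_congr rfl fun a _ => ?_
  have := wsum_action_of_tail hc σ (wsum_tail_of_succ hc σ t ih h a)
  rw [pr_evHU, show (deviate g i σ) i = σ from Function.update_self i σ g] at this
  refine Eq.trans ?_ (this.trans (by ring))
  rfl

theorem wsum_tailValue {g : G.Profile} {P : G.Kernels} {r : G.Rewards}
    (hc : ModelConsistent g P r) {i : ι} (σ : G.Strategy i) {t : Fin T} (h : G.Hist t i)
    (a : G.U t i) :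
    wsum (deviate g i σ) (fun ω => ∑ s ∈ Finset.Ioi t, G.reward s i ω) (evHU h a) =
      pr (deviate g i σ) (evHU h a) * tailValue P r σ t h a :=
  wsum_tail_of_succ hc σ t (fun hs k => wsum_rewardToGo hc σ ⟨t + 1, hs⟩ k) h a

theorem condE_tail {g : G.Profile} {P : G.Kernels} {r : G.Rewards}
    (hc : ModelConsistent g P r) {i : ι} (σ : G.Strategy i) {t : Fin T} {h : G.Hist t i}
    {a : G.U t i} (hpr : pr (deviate g i σ) (evHU h a) ≠ 0) :
    condE (deviate g i σ) (fun ω => ∑ s ∈ Finset.Ioi t, G.reward s i ω) (evHU h a) =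
      tailValue P r σ t h a := by
  rw [condE_eq, wsum_tailValue hc, mul_div_cancel_left₀ _ hpr]

theorem condE_action {g : G.Profile} {P : G.Kernels} {r : G.Rewards}
    (hc : ModelConsistent g P r) {i : ι} (σ : G.Strategy i) {t : Fin T} {h : G.Hist t i}
    {a : G.U t i} (hpr : pr (deviate g i σ) (evHU h a) ≠ 0) :
    condE (deviate g i σ) (fun ω => ∑ s ∈ Finset.Ici t, G.reward s i ω) (evHU h a) =
      actionValue P r σ t h a := by
  rw [condE_eq, wsum_action_of_tail hc σ (wsum_tailValue hc σ h a), mul_div_cancel_left₀ _ hpr]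

/-! ### Consistent objects for fully mixed profiles -/

theorem sum_pr_inter {κ : Type*} [Fintype κ] (g : G.Profile) (A : Set G.Outcome)
    (φ : G.Outcome → κ) : ∑ k, pr g ({ω | φ ω = k} ∩ A) = pr g A := by
  simp only [pr_eq_wsum, Set.inter_comm _ A]
  exact (wsum_fiberwise g _ A φ).symm

theorem condPr_mem_stdSimplex {κ : Type*} [Fintype κ] {g : G.Profile} {A : Set G.Outcome}
    (hA : pr g A ≠ 0) (φ : G.Outcome → κ) :
    (fun k => condPr g {ω | φ ω = k} A) ∈ stdSimplex ℝ κ := by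
  refine ⟨fun k => div_nonneg (pr_nonneg g _) (pr_nonneg g _), ?_⟩
  simp only [condPr, ← Finset.sum_div, sum_pr_inter, div_self hA]

/-- The conditional laws under `g` itself serve as the model, because they are insensitive to the
player's own strategy. -/
theorem FullyMixed.exists_modelConsistent {g : G.Profile} (hg : FullyMixed g) :
    ∃ (P : G.Kernels) (r : G.Rewards), ModelConsistent g P r := by
  have hpr : ∀ {i : ι} {t : Fin T} (h : G.Hist t i) (a : G.U t i), pr g (evHU h a) ≠ 0 :=
    fun h a => (hg.pr_pos (evHU_nonempty h a)).ne'
  refine ⟨fun i t h a => ⟨_, condPr_mem_stdSimplex (hpr h a) (G.info t.1 i)⟩,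
    fun i t h a => ⟨condE g (G.reward t i) (evHU h a), abs_le.1 <|
      abs_condE_le zero_le_one (abs_reward_le t i)⟩, ?_⟩
  exact fun i t h a => ⟨fun hs z => hg.condPr_deviate z,
    hg.condE_deviate fun ω ω' hω => hω.reward_eq i⟩

theorem exists_qConsistent (g : G.Profile) :
    ∃ Q : G.QFunctions, QConsistent g Q :=
  ⟨fun i τ h a => ⟨condE g (fun ω => ∑ t ∈ Finset.Ici τ, G.reward t i ω) (evHU h a),
    abs_le.1 <| abs_condE_le (Nat.cast_nonneg T) (abs_sum_reward_le _ i)⟩, fun _ _ _ _ => rfl⟩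

theorem FullyMixed.exists_beliefConsistent {g : G.Profile} (hg : FullyMixed g) :
    ∃ μ : G.Beliefs, BeliefConsistent g μ :=
  ⟨fun i t h => ⟨_, condPr_mem_stdSimplex (hg.pr_pos (evH_nonempty h)).ne' (G.node t i)⟩,
    fun _ _ _ _ => rfl⟩

theorem qConsistent_iff {g : G.Profile} (hg : FullyMixed g) {P : G.Kernels} {r : G.Rewards}
    (hc : ModelConsistent g P r) (Q : G.QFunctions) :
    QConsistent g Q ↔ ∀ i t h a, (Q i t h a : ℝ) = actionValue P r (g i) t h a := by
  have key : ∀ i t (h : G.Hist t i) a,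
      condE g (fun ω => ∑ s ∈ Finset.Ici t, G.reward s i ω) (evHU h a) =
        actionValue P r (g i) t h a := fun i t h a => by
    have := condE_action hc (g i) (h := h) (a := a)
    rw [deviate_self] at this
    exact this (hg.pr_pos (evHU_nonempty h a)).ne'
  simp only [QConsistent, key]

theorem pr_deviate_switch_evHU (g : G.Profile) {i : ι} {t : Fin T} (h : G.Hist t i) (a : G.U t i)
    (σ : G.Strategy i) :
    pr (deviate g i (switch (t + 1) (g i) σ)) (evHU h a) = pr g (evHU h a) := by
  rw [pr_eq_wsum, pr_eq_wsum]
  exact wsum_congr (Nat.succ_le_of_lt t.2)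
    (fun j s hs => deviate_eq_of_eq g i (switch_of_lt _ _ hs) j) (fun _ _ _ => rfl)
    (Agree.mem_evHU_iff h a)

theorem tailValue_switch {i : ι} (P : G.Kernels) (r : G.Rewards) (σ σ' : G.Strategy i)
    (t : Fin T) (h : G.Hist t i) (a : G.U t i) :
    tailValue P r (switch (t + 1) σ σ') t h a = tailValue P r σ' t h a :=
  tailValue_congr P r t (fun _ hs => switch_of_le σ σ' (Nat.succ_le_of_lt hs)) h a

/-- The strategy `σ` may fail to reach `(h, a)`. Following `g i` up to time `t` reaches it and
leaves the tail value unchanged, so the value is a conditional expectation of at most `T` rewards.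
-/
theorem abs_actionValue_le {g : G.Profile} (hg : FullyMixed g) {P : G.Kernels} {r : G.Rewards}
    (hc : ModelConsistent g P r) {i : ι} (σ : G.Strategy i) {t : Fin T} (h : G.Hist t i)
    (a : G.U t i) : |actionValue P r σ t h a| ≤ T := by
  rw [actionValue, ← tailValue_switch P r (g i) σ, ← actionValue, ← condE_action hc]
  · exact abs_condE_le (Nat.cast_nonneg T) (abs_sum_reward_le _ i)
  · rw [pr_deviate_switch_evHU]; exact (hg.pr_pos (evHU_nonempty h a)).ne'

/-- Every admissible conditional payoff is a tail value, hence at most that of `τ`. The maximum is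
attained by grafting `τ` onto `g i` after time `t`. -/
theorem isGreatest_tailValue {g : G.Profile} (hg : FullyMixed g) {P : G.Kernels} {r : G.Rewards}
    (hc : ModelConsistent g P r) {τ : G.Profile} (hτ : RationalUnderModel τ P r) (i : ι)
    (t : Fin T) (h : G.Hist t i) (a : G.U t i) :
    IsGreatest {x : ℝ | ∃ σ : G.Strategy i, pr (deviate g i σ) (evHU h a) ≠ 0 ∧
      x = condE (deviate g i σ) (fun ω => ∑ s ∈ Finset.Ioi t, G.reward s i ω) (evHU h a)}
      (tailValue P r (τ i) t h a) := by
  have hpr : pr (deviate g i (switch (t + 1) (g i) (τ i))) (evHU h a) ≠ 0 := by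
    rw [pr_deviate_switch_evHU]; exact (hg.pr_pos (evHU_nonempty h a)).ne'
  refine ⟨⟨switch (t + 1) (g i) (τ i), hpr, ?_⟩, ?_⟩
  · rw [condE_tail hc _ hpr, tailValue_switch]
  · rintro _ ⟨σ, hσ, rfl⟩
    rw [condE_tail hc _ hσ]
    exact tailValue_le (fun hs k => hτ i ⟨t + 1, hs⟩ k σ) h a

theorem qConsistentMax_iff {g : G.Profile} (hg : FullyMixed g) {P : G.Kernels} {r : G.Rewards}
    (hc : ModelConsistent g P r) {τ : G.Profile} (hτ : RationalUnderModel τ P r)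
    (Q : G.QFunctions) :
    QConsistentMax g Q ↔ ∀ i t h a, (Q i t h a : ℝ) = actionValue P r (τ i) t h a := by
  constructor
  · intro hQ i t h a
    obtain ⟨ρ, m, hρ, hm, hq⟩ := hQ i t h a
    -- One admissible completion suffices to identify `ρ` with the model reward.
    have hpr : pr (deviate g i (g i)) (evHU h a) ≠ 0 := by
      rw [deviate_self]; exact (hg.pr_pos (evHU_nonempty h a)).ne'
    rw [hq, actionValue, hm.unique (isGreatest_tailValue hg hc hτ i t h a), ← hρ (g i) hpr,
      (hc i t h a).2 (g i) hpr]
  · exact fun hQ i t h a => ⟨_, _, (hc i t h a).2, isGreatest_tailValue hg hc hτ i t h a, hQ i t h a⟩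

theorem exists_rationalUnderModel (P : G.Kernels) (r : G.Rewards) :
    ∃ τ : G.Profile, RationalUnderModel τ P r := by
  choose τ hτ using fun i : ι => exists_optimal (i := i) P r
  exact ⟨τ, fun i t h σ => hτ i σ t h⟩

theorem exists_qConsistentMax {g : G.Profile} (hg : FullyMixed g) {P : G.Kernels} {r : G.Rewards}
    (hc : ModelConsistent g P r) : ∃ Q : G.QFunctions, QConsistentMax g Q := by
  obtain ⟨τ, hτ⟩ := exists_rationalUnderModel P r
  exact ⟨fun i t h a => ⟨actionValue P r (τ i) t h a, abs_le.1 (abs_actionValue_le hg hc _ h a)⟩,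
    (qConsistentMax_iff hg hc hτ _).2 fun _ _ _ _ => rfl⟩

/-! ### Values from a node on -/

theorem node_eq_iff {t : Fin T} {i : ι} {ω ω' : G.Outcome} :
    G.node t i ω = G.node t i ω' ↔
      Agree t ω ω' ∧ ∀ j < i, G.action t j ω = G.action t j ω' := by
  simp only [node, Prod.mk.injEq, funext_iff, Subtype.forall, Agree, and_assoc]
  rfl

/-- The probability of the moves along `ω` that come before the node `O_t^i`. -/
def preProb (g : G.Profile) (t : Fin T) (i : ι) (ω : G.Outcome) : ℝ :=
  (G.initLaw.1 ω.1.1 * ∏ s ∈ timesBefore T t, stepProb g s ω) *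
    ∏ j with ¬ i ≤ j, moveProb g t j ω

theorem timesFrom_eq (t : Fin T) : timesFrom T t = insert t (Finset.Ioi t) := by
  ext s
  simp only [Finset.mem_filter, Finset.mem_univ, true_and, Finset.mem_insert, Finset.mem_Ioi,
    Fin.lt_def, Fin.ext_iff]
  omega

theorem prob_eq_preProb_mul_contProb (g : G.Profile) (t : Fin T) (i : ι) (ω : G.Outcome) :
    prob g ω = preProb g t i ω * contProb g t i ω := by
  rw [prob_eq_mul g t, timesFrom_eq, Finset.prod_insert Finset.notMem_Ioi_self, preProb, contProb,
    stepProb, ← Finset.prod_filter_mul_prod_filter_not Finset.univ (fun j : ι => i ≤ j)]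
  simp only [stepProb]
  ring

theorem preProb_eq_of_node_eq (g : G.Profile) {t : Fin T} {i : ι} {ω ω' : G.Outcome}
    (h : G.node t i ω = G.node t i ω') : preProb g t i ω = preProb g t i ω' := by
  obtain ⟨hA, hj⟩ := node_eq_iff.1 h
  have h1 : ∏ s ∈ timesBefore T t, stepProb g s ω = ∏ s ∈ timesBefore T t, stepProb g s ω' :=
    Finset.prod_congr rfl fun s hs =>
      (hA.mono (Nat.succ_le_of_lt (Finset.mem_filter.1 hs).2)).stepProb_eq g
  have h2 : ∏ j with ¬ i ≤ j, moveProb g t j ω = ∏ j with ¬ i ≤ j, moveProb g t j ω' :=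
    Finset.prod_congr rfl fun j hij => by
      unfold moveProb
      rw [hA.H_eq, hj j (not_le.1 (Finset.mem_filter.1 hij).2)]
  unfold preProb
  rw [hA.1, h1, h2]

/-- Play that starts from a node reaches some terminal node. -/
theorem sum_contProb (g : G.Profile) (t : Fin T) (i : ι) (ω₀ : G.Outcome) :
    ∑ ω with G.node t i ω = G.node t i ω₀, contProb g t i ω = 1 := by
  -- Forcing the players before `i` to repeat the actions of `ω₀` at time `t` reduces play from a
  -- node to play from the start of a period.
  let g' : G.Profile := fun j s => if hs : s = t ∧ j < i then fun _ =>
    ⟨Pi.single (G.action s j ω₀) 1, single_mem_stdSimplex ℝ _⟩ else g j s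
  rw [← sum_continuation g' (T - t) t (by have := t.2; omega) ω₀, Finset.sum_filter,
    Finset.sum_filter]
  refine Finset.sum_congr rfl fun ω _ => ?_
  simp only [node_eq_iff]
  by_cases hA : Agree t ω ω₀
  · simp only [hA, true_and, if_true]
    have hlate : ∏ s ∈ Finset.Ioi t, stepProb g' s ω =
        ∏ s ∈ Finset.Ioi t, ((∏ j, moveProb g s j ω) * noiseProb s ω) :=
      Finset.prod_congr rfl fun s hs => by
        have : s ≠ t := (Finset.mem_Ioi.1 hs).ne'
        simp [stepProb, moveProb, g', this]
    rw [timesFrom_eq, Finset.prod_insert Finset.notMem_Ioi_self, hlate, contProb, stepProb,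
      ← Finset.prod_filter_mul_prod_filter_not Finset.univ (fun j : ι => i ≤ j)]
    have h1 : ∏ j with i ≤ j, moveProb g' t j ω = ∏ j with i ≤ j, moveProb g t j ω :=
      Finset.prod_congr rfl fun j hj => by
        simp [moveProb, g', (Finset.mem_filter.1 hj).2.not_gt]
    have h2 : ∏ j with ¬ i ≤ j, moveProb g' t j ω =
        if ∀ j < i, G.action t j ω = G.action t j ω₀ then 1 else 0 := by
      split_ifs with hj
      · refine Finset.prod_eq_one fun j hij => ?_
        have hji := not_le.1 (Finset.mem_filter.1 hij).2
        simp [moveProb, g', hji, hj j hji]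
      · push Not at hj
        obtain ⟨j, hji, hne⟩ := hj
        refine Finset.prod_eq_zero (Finset.mem_filter.2 ⟨Finset.mem_univ j, hji.not_ge⟩) ?_
        simp [moveProb, g', hji, hne]
    rw [h1, h2]
    split_ifs <;> ring
  · simp only [hA, false_and, if_false]

theorem prob_deviate_switch_eq_preProb_mul (g : G.Profile) {t : Fin T} {i : ι} (σ : G.Strategy i)
    (ω : G.Outcome) : prob (deviate g i (switch t (g i) σ)) ω =
      preProb g t i ω * contProb (deviate g i σ) t i ω := by
  rw [prob_eq_preProb_mul_contProb _ t i]
  congr 1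
  · have h1 : ∏ s ∈ timesBefore T t, stepProb (deviate g i (switch t (g i) σ)) s ω =
        ∏ s ∈ timesBefore T t, stepProb g s ω := Finset.prod_congr rfl fun s hs => by
      unfold stepProb moveProb
      simp only [deviate_eq_of_eq g i (switch_of_lt (g i) σ (Finset.mem_filter.1 hs).2)]
    have h2 : ∏ j with ¬ i ≤ j, moveProb (deviate g i (switch t (g i) σ)) t j ω =
        ∏ j with ¬ i ≤ j, moveProb g t j ω := Finset.prod_congr rfl fun j hj => by
      have : j ≠ i := (not_le.1 (Finset.mem_filter.1 hj).2).ne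
      simp [moveProb, deviate, this]
    unfold preProb
    rw [h1, h2]
  · unfold contProb moveProb
    congr 1
    · simp only [deviate_congr g i (switch_of_le (g i) σ (le_refl (t : ℕ)))]
    · exact Finset.prod_congr rfl fun s hs => by
        simp only [deviate_congr g i (switch_of_le (g i) σ (Fin.lt_def.1 (Finset.mem_Ioi.1 hs)).le)]

/-- A node determines the history of its player, so either both sides vanish or `evH h` contains the
whole node event, whose probability is the common value of `preProb`. Multiplying by it gives play
that follows `g` before time `t` and `σ` from `t` on. -/
theorem contE_mul_pr (g : G.Profile) {t : Fin T} {i : ι} (σ : G.Strategy i)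
    (F : G.Outcome → ℝ) (h : G.Hist t i) (o : G.Node t i) :
    contE (deviate g i σ) F o * pr g ({ω | G.node t i ω = o} ∩ evH h) =
      wsum (deviate g i (switch t (g i) σ)) F (evH h ∩ {ω | G.node t i ω = o}) := by
  rw [Set.inter_comm]
  rcases (evH h ∩ {ω | G.node t i ω = o}).eq_empty_or_nonempty with he | ⟨ω₀, h1, h2⟩
  · rw [he]; simp [wsum, pr]
  · obtain rfl : G.node t i ω₀ = o := h2
    have hset : evH h ∩ {ω | G.node t i ω = G.node t i ω₀} =
        {ω | G.node t i ω = G.node t i ω₀} := by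
      refine Set.inter_eq_right.2 fun ω hω => ?_
      exact Eq.trans ((node_eq_iff.1 hω).1.H_eq i) h1
    have hfil : ∀ F' : G.Outcome → ℝ, ∑ ω with ω ∈ {ω | G.node t i ω = G.node t i ω₀}, F' ω =
        ∑ ω with G.node t i ω = G.node t i ω₀, F' ω := fun F' =>
      Finset.sum_congr (by ext; simp) fun _ _ => rfl
    have hpr : pr g {ω | G.node t i ω = G.node t i ω₀} = preProb g t i ω₀ := by
      unfold pr
      rw [hfil, ← mul_one (preProb g t i ω₀), ← sum_contProb g t i ω₀, Finset.mul_sum]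
      refine Finset.sum_congr rfl fun ω hω => ?_
      rw [prob_eq_preProb_mul_contProb g t i, preProb_eq_of_node_eq g (Finset.mem_filter.1 hω).2]
    rw [hset, hpr]
    unfold wsum contE
    rw [hfil, mul_comm, Finset.mul_sum]
    refine Finset.sum_congr rfl fun ω hω => ?_
    rw [prob_deviate_switch_eq_preProb_mul,
      preProb_eq_of_node_eq g (Finset.mem_filter.1 hω).2, mul_assoc]

/-- Under consistent beliefs the expected payoff at an information set is the expected past reward
plus the reward-to-go. -/
theorem sum_contE_mul_belief {g : G.Profile} (hg : FullyMixed g) {P : G.Kernels} {r : G.Rewards}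
    (hc : ModelConsistent g P r) {μ : G.Beliefs} (hμ : BeliefConsistent g μ) {i : ι} {t : Fin T}
    (h : G.Hist t i) (σ : G.Strategy i) :
    ∑ o, contE (deviate g i σ) (G.payoff i) o * (μ i t h).1 o =
      condE g (fun ω => ∑ s ∈ Finset.Iio t, G.reward s i ω) (evH h) +
        rewardToGo P r σ t t.2 h := by
  have hpr := (hg.pr_pos (evH_nonempty h)).ne'
  have hagree : ∀ j (s : Fin T), (s : ℕ) < t →
      deviate g i (switch t (g i) σ) j s = g j s :=
    fun j s hs => deviate_eq_of_eq g i (switch_of_lt _ _ hs) j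
  have hpay : G.payoff i = fun ω =>
      ∑ s ∈ Finset.Iio t, G.reward s i ω + ∑ s ∈ Finset.Ici t, G.reward s i ω := by
    funext ω
    rw [← Finset.sum_union (Finset.disjoint_left.2 fun s hs hs' =>
      (Finset.mem_Iio.1 hs).not_ge (Finset.mem_Ici.1 hs'))]
    refine Finset.sum_congr ?_ fun _ _ => rfl
    ext s; simp [lt_or_ge]
  have hpast : wsum (deviate g i (switch t (g i) σ))
      (fun ω => ∑ s ∈ Finset.Iio t, G.reward s i ω) (evH h) =
      wsum g (fun ω => ∑ s ∈ Finset.Iio t, G.reward s i ω) (evH h) :=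
    wsum_congr t.2.le hagree (fun ω ω' hω => Finset.sum_congr rfl fun s hs =>
      (hω.mono (Nat.succ_le_of_lt (Fin.lt_def.1 (Finset.mem_Iio.1 hs)))).reward_eq i)
      (Agree.mem_evH_iff h)
  have hprdev : pr (deviate g i (switch t (g i) σ)) (evH h) = pr g (evH h) := by
    rw [pr_eq_wsum, pr_eq_wsum]
    exact wsum_congr t.2.le hagree (fun _ _ _ => rfl) (Agree.mem_evH_iff h)
  -- Bayesian beliefs cancel the node probabilities; summing over nodes leaves one expectation over
  -- `evH h`.
  simp only [hμ i t h, condPr, ← mul_div_assoc, ← Finset.sum_div, contE_mul_pr]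
  rw [← wsum_fiberwise, hpay, wsum_add, hpast, wsum_rewardToGo hc, hprdev,
    rewardToGo_congr P r t (fun s hs => switch_of_le (g i) σ hs), condE_eq, add_div,
    mul_div_cancel_left₀ _ hpr]

/-! ### Limits -/

@[fun_prop]
theorem continuous_stdSimplex_apply {X α : Type*} [TopologicalSpace X] [Fintype α]
    {f : X → stdSimplex ℝ α} (hf : Continuous f) (a : α) : Continuous fun x => (f x).1 a :=
  (continuous_apply a).comp (continuous_subtype_val.comp hf)

theorem continuous_actionValue {i : ι} (t : Fin T)
    (hJ : ∀ (hs : (t : ℕ) + 1 < T) (k : G.Hist ⟨t + 1, hs⟩ i),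
      Continuous fun x : G.Kernels × G.Rewards × G.Strategy i =>
        rewardToGo x.1 x.2.1 x.2.2 (t + 1) hs k) (h : G.Hist t i) (a : G.U t i) :
    Continuous fun x : G.Kernels × G.Rewards × G.Strategy i =>
      actionValue x.1 x.2.1 x.2.2 t h a := by
  refine Continuous.add (by fun_prop) ?_
  unfold tailValue
  split_ifs with hs
  · exact continuous_finsetSum _ fun k _ => (hJ hs k).mul (by fun_prop)
  · exact continuous_const

theorem continuous_rewardToGo {i : ι} (t : Fin T) (h : G.Hist t i) :
    Continuous fun x : G.Kernels × G.Rewards × G.Strategy i =>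
      rewardToGo x.1 x.2.1 x.2.2 t t.2 h := by
  induction t using backward_induction with
  | step t ih =>
  simp only [rewardToGo_eq]
  exact continuous_finsetSum _ fun a _ => (continuous_actionValue t ih h a).mul (by fun_prop)

theorem tendsto_rewardToGo {Ps : ℕ → G.Kernels} {P : G.Kernels} {rs : ℕ → G.Rewards}
    {r : G.Rewards} (hP : Tendsto Ps atTop (𝓝 P)) (hr : Tendsto rs atTop (𝓝 r)) {i : ι}
    {σs : ℕ → G.Strategy i} {σ : G.Strategy i} (hσ : Tendsto σs atTop (𝓝 σ)) (t : Fin T)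
    (h : G.Hist t i) :
    Tendsto (fun n => rewardToGo (Ps n) (rs n) (σs n) t t.2 h) atTop
      (𝓝 (rewardToGo P r σ t t.2 h)) :=
  ((continuous_rewardToGo t h).tendsto (P, r, σ)).comp (hP.prodMk_nhds (hr.prodMk_nhds hσ))

theorem tendsto_actionValue {Ps : ℕ → G.Kernels} {P : G.Kernels} {rs : ℕ → G.Rewards}
    {r : G.Rewards} (hP : Tendsto Ps atTop (𝓝 P)) (hr : Tendsto rs atTop (𝓝 r)) {i : ι}
    {σs : ℕ → G.Strategy i} {σ : G.Strategy i} (hσ : Tendsto σs atTop (𝓝 σ)) (t : Fin T)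
    (h : G.Hist t i) (a : G.U t i) :
    Tendsto (fun n => actionValue (Ps n) (rs n) (σs n) t h a) atTop
      (𝓝 (actionValue P r σ t h a)) :=
  ((continuous_actionValue t (fun hs k => continuous_rewardToGo ⟨t + 1, hs⟩ k) h a).tendsto
    (P, r, σ)).comp (hP.prodMk_nhds (hr.prodMk_nhds hσ))

/-- Serves both model-free versions: `τs` is the mixed sequence itself in version 1 and a sequence
of optimal profiles in version 2. -/
theorem eq_actionValue_of_tendsto {Ps : ℕ → G.Kernels} {P : G.Kernels} {rs : ℕ → G.Rewards}
    {r : G.Rewards} (hP : Tendsto Ps atTop (𝓝 P)) (hr : Tendsto rs atTop (𝓝 r))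
    {τs : ℕ → G.Profile} {τ : G.Profile} (hτ : Tendsto τs atTop (𝓝 τ)) {Qs : ℕ → G.QFunctions}
    {Q : G.QFunctions} (hQ : Tendsto Qs atTop (𝓝 Q))
    (hval : ∀ n i t h a, (Qs n i t h a : ℝ) = actionValue (Ps n) (rs n) (τs n i) t h a)
    (i : ι) (t : Fin T) (h : G.Hist t i) (a : G.U t i) :
    (Q i t h a : ℝ) = actionValue P r (τ i) t h a := by
  have hcont : Continuous fun Q : G.QFunctions => (Q i t h a : ℝ) := by fun_prop
  have h1 := (hcont.tendsto Q).comp hQ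
  have h2 := tendsto_actionValue hP hr (tendsto_pi_nhds.1 hτ i) t h a
  refine tendsto_nhds_unique h1 (h2.congr fun n => (hval n i t h a).symm)

/-- Optimality is a family of weak inequalities between continuous functions, so it is closed. -/
theorem rationalUnderModel_of_tendsto {Ps : ℕ → G.Kernels} {P : G.Kernels} {rs : ℕ → G.Rewards}
    {r : G.Rewards} (hP : Tendsto Ps atTop (𝓝 P)) (hr : Tendsto rs atTop (𝓝 r))
    {τs : ℕ → G.Profile} {τ : G.Profile} (hτ : Tendsto τs atTop (𝓝 τ))
    (hrat : ∀ n, RationalUnderModel (τs n) (Ps n) (rs n)) : RationalUnderModel τ P r :=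
  fun i t h σ => le_of_tendsto_of_tendsto' (tendsto_rewardToGo hP hr tendsto_const_nhds t h)
    (tendsto_rewardToGo hP hr (tendsto_pi_nhds.1 hτ i) t h) fun n => hrat n i t h σ

section Limit

variable {g : G.Profile} {gs : ℕ → G.Profile} {Ps : ℕ → G.Kernels} {rs : ℕ → G.Rewards}
  {P : G.Kernels} {r : G.Rewards}

theorem rationalUnderModel_iff_rationalUnderQ (hfm : ∀ n, FullyMixed (gs n))
    (hc : ∀ n, ModelConsistent (gs n) (Ps n) (rs n)) (hg : Tendsto gs atTop (𝓝 g))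
    (hP : Tendsto Ps atTop (𝓝 P)) (hr : Tendsto rs atTop (𝓝 r)) {Qs : ℕ → G.QFunctions}
    {Q : G.QFunctions} (hQc : ∀ n, QConsistent (gs n) (Qs n)) (hQ : Tendsto Qs atTop (𝓝 Q)) :
    RationalUnderModel g P r ↔ RationalUnderQ g Q := by
  have hval := eq_actionValue_of_tendsto hP hr hg hQ
    fun n => (qConsistent_iff (hfm n) (hc n) _).1 (hQc n)
  simp only [rationalUnderModel_iff, RationalUnderQ, hval]
  rfl

theorem rationalUnderModel_iff_rationalUnderQ_max (hfm : ∀ n, FullyMixed (gs n))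
    (hc : ∀ n, ModelConsistent (gs n) (Ps n) (rs n))
    (hP : Tendsto Ps atTop (𝓝 P)) (hr : Tendsto rs atTop (𝓝 r)) {τs : ℕ → G.Profile}
    {τ : G.Profile} (hrat : ∀ n, RationalUnderModel (τs n) (Ps n) (rs n))
    (hτ : Tendsto τs atTop (𝓝 τ)) {Qs : ℕ → G.QFunctions}
    {Q : G.QFunctions} (hQc : ∀ n, QConsistentMax (gs n) (Qs n)) (hQ : Tendsto Qs atTop (𝓝 Q)) :
    RationalUnderModel g P r ↔ RationalUnderQ g Q := by
  have hval := eq_actionValue_of_tendsto hP hr hτ hQ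
    fun n => (qConsistentMax_iff (hfm n) (hc n) (hrat n) _).1 (hQc n)
  rw [rationalUnderModel_iff_of_optimal g P r τ (rationalUnderModel_of_tendsto hP hr hτ hrat)]
  simp only [RationalUnderQ, hval]
  rfl

theorem continuous_contE {t : Fin T} {i : ι} (F : G.Outcome → ℝ) (o : G.Node t i) :
    Continuous fun g : G.Profile => contE g F o := by
  unfold contE contProb moveProb
  fun_prop

theorem rationalUnderModel_iff_rationalGiven (hfm : ∀ n, FullyMixed (gs n))
    (hc : ∀ n, ModelConsistent (gs n) (Ps n) (rs n)) (hg : Tendsto gs atTop (𝓝 g))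
    (hP : Tendsto Ps atTop (𝓝 P)) (hr : Tendsto rs atTop (𝓝 r)) {μs : ℕ → G.Beliefs}
    {μ : G.Beliefs} (hμc : ∀ n, BeliefConsistent (gs n) (μs n)) (hμ : Tendsto μs atTop (𝓝 μ)) :
    RationalUnderModel g P r ↔ RationalGiven g μ := by
  have hE : ∀ (i : ι) (t : Fin T) (h : G.Hist t i) (σ : G.Strategy i),
      Tendsto (fun n => ∑ o, contE (deviate (gs n) i σ) (G.payoff i) o * (μs n i t h).1 o) atTop
        (𝓝 (∑ o, contE (deviate g i σ) (G.payoff i) o * (μ i t h).1 o)) := by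
    intro i t h σ
    refine tendsto_finsetSum _ fun o _ => Tendsto.mul ?_ ?_
    · exact ((continuous_contE (G.payoff i) o).tendsto _).comp (hg.update i tendsto_const_nhds)
    · have hcont : Continuous fun μ : G.Beliefs => (μ i t h).1 o := by fun_prop
      exact (hcont.tendsto μ).comp hμ
  -- For each `n`, compare `σ` with the limit strategy `g i`, both played against the others in `gs
  -- n`. The expected past rewards coincide and drop out before the limit is taken.
  have key : ∀ (i : ι) (t : Fin T) (h : G.Hist t i) (σ : G.Strategy i),
      ∑ o, contE (deviate g i σ) (G.payoff i) o * (μ i t h).1 o -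
        ∑ o, contE g (G.payoff i) o * (μ i t h).1 o =
      rewardToGo P r σ t t.2 h - rewardToGo P r (g i) t t.2 h := by
    intro i t h σ
    have h1 := (hE i t h σ).sub (hE i t h (g i))
    rw [deviate_self] at h1
    refine tendsto_nhds_unique h1 (Tendsto.congr (fun n => ?_)
      ((tendsto_rewardToGo hP hr (tendsto_const_nhds (x := σ)) t h).sub
        (tendsto_rewardToGo hP hr (tendsto_const_nhds (x := g i)) t h)))
    rw [sum_contE_mul_belief (hfm n) (hc n) (hμc n), sum_contE_mul_belief (hfm n) (hc n) (hμc n)]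
    ring
  refine forall₄_congr fun i t h σ => ?_
  rw [← sub_nonpos, ← key, sub_nonpos]

end Limit

/-! ### Compactness and the pairwise equivalences -/

theorem exists_convergent_choice {α : Type*} [TopologicalSpace α] [CompactSpace α]
    [FirstCountableTopology α] {p : ℕ → α → Prop} (h : ∀ n, ∃ x, p n x) :
    ∃ φ : ℕ → ℕ, StrictMono φ ∧ ∃ (xs : ℕ → α) (x : α),
      (∀ n, p (φ n) (xs n)) ∧ Tendsto xs atTop (𝓝 x) := by
  choose ys hys using h
  obtain ⟨x, φ, hφ, hx⟩ := CompactSpace.tendsto_subseq ys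
  exact ⟨φ, hφ, ys ∘ φ, x, fun n => hys (φ n), hx⟩

instance compactSpace_stdSimplex {α : Type*} [Fintype α] : CompactSpace (stdSimplex ℝ α) :=
  isCompact_iff_compactSpace.1 (isCompact_stdSimplex ℝ α)

instance firstCountableTopology_stdSimplex {α : Type*} [Fintype α] :
    FirstCountableTopology (stdSimplex ℝ α) :=
  inferInstanceAs (FirstCountableTopology {p : α → ℝ // p ∈ stdSimplex ℝ α})

instance : FirstCountableTopology G.Profile := inferInstance

instance : FirstCountableTopology G.Kernels := inferInstance

instance : FirstCountableTopology G.Beliefs := inferInstance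

theorem exists_modelBasedSE_iff_modelFreeSE (g : G.Profile) :
    (∃ (P : G.Kernels) (r : G.Rewards), IsModelBasedSE g P r) ↔
      ∃ Q : G.QFunctions, IsModelFreeSE g Q := by
  constructor
  · rintro ⟨P, r, hrat, gs, Ps, rs, hfm, hc, hg, hP, hr⟩
    obtain ⟨φ, hφ, Qs, Q, hQc, hQ⟩ := exists_convergent_choice fun n => exists_qConsistent (gs n)
    have hφ := hφ.tendsto_atTop
    exact ⟨Q, (rationalUnderModel_iff_rationalUnderQ (fun n => hfm (φ n)) (fun n => hc (φ n))
      (hg.comp hφ) (hP.comp hφ) (hr.comp hφ) hQc hQ).1 hrat,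
      gs ∘ φ, Qs, fun n => hfm (φ n), hQc, hg.comp hφ, hQ⟩
  · rintro ⟨Q, hrat, gs, Qs, hfm, hQc, hg, hQ⟩
    obtain ⟨φ, hφ, xs, ⟨P, r⟩, hc, hx⟩ := exists_convergent_choice
      (α := G.Kernels × G.Rewards) (p := fun n x => ModelConsistent (gs n) x.1 x.2)
      fun n => Prod.exists.2 (hfm n).exists_modelConsistent
    have hφ := hφ.tendsto_atTop
    exact ⟨P, r, (rationalUnderModel_iff_rationalUnderQ (fun n => hfm (φ n)) hc
      (hg.comp hφ) hx.fst_nhds hx.snd_nhds (fun n => hQc (φ n)) (hQ.comp hφ)).2 hrat,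
      gs ∘ φ, _, _, fun n => hfm (φ n), hc, hg.comp hφ, hx.fst_nhds, hx.snd_nhds⟩

theorem exists_modelBasedSE_iff_modelFreeSE₂ (g : G.Profile) :
    (∃ (P : G.Kernels) (r : G.Rewards), IsModelBasedSE g P r) ↔
      ∃ Q : G.QFunctions, IsModelFreeSE₂ g Q := by
  constructor
  · rintro ⟨P, r, hrat, gs, Ps, rs, hfm, hc, hg, hP, hr⟩
    obtain ⟨φ, hφ, xs, ⟨Q, τ⟩, hxc, hx⟩ := exists_convergent_choice
      (α := G.QFunctions × G.Profile)
      -- An optimal profile of the `n`-th model is chosen along with `Q`, so that both converge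
      -- along one subsequence.
      (p := fun n x => QConsistentMax (gs n) x.1 ∧ RationalUnderModel x.2 (Ps n) (rs n)) fun n => by
        obtain ⟨Q, hQ⟩ := exists_qConsistentMax (hfm n) (hc n)
        obtain ⟨τ, hτ⟩ := exists_rationalUnderModel (Ps n) (rs n)
        exact ⟨(Q, τ), hQ, hτ⟩
    have hφ := hφ.tendsto_atTop
    exact ⟨Q, (rationalUnderModel_iff_rationalUnderQ_max (fun n => hfm (φ n)) (fun n => hc (φ n))
      (hP.comp hφ) (hr.comp hφ) (fun n => (hxc n).2) hx.snd_nhds (fun n => (hxc n).1)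
      hx.fst_nhds).1 hrat,
      gs ∘ φ, _, fun n => hfm (φ n), fun n => (hxc n).1, hg.comp hφ, hx.fst_nhds⟩
  · rintro ⟨Q, hrat, gs, Qs, hfm, hQc, hg, hQ⟩
    obtain ⟨φ, hφ, xs, ⟨P, r, τ⟩, hxc, hx⟩ := exists_convergent_choice
      (α := G.Kernels × G.Rewards × G.Profile)
      (p := fun n x => ModelConsistent (gs n) x.1 x.2.1 ∧ RationalUnderModel x.2.2 x.1 x.2.1)
      fun n => by
        obtain ⟨P, r, hc⟩ := (hfm n).exists_modelConsistent
        obtain ⟨τ, hτ⟩ := exists_rationalUnderModel P r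
        exact ⟨(P, r, τ), hc, hτ⟩
    have hφ := hφ.tendsto_atTop
    exact ⟨P, r, (rationalUnderModel_iff_rationalUnderQ_max (fun n => hfm (φ n))
      (fun n => (hxc n).1) hx.fst_nhds hx.snd_nhds.fst_nhds (fun n => (hxc n).2)
      hx.snd_nhds.snd_nhds (fun n => hQc (φ n)) (hQ.comp hφ)).2 hrat,
      gs ∘ φ, _, _, fun n => hfm (φ n), fun n => (hxc n).1, hg.comp hφ, hx.fst_nhds,
      hx.snd_nhds.fst_nhds⟩

theorem exists_modelBasedSE_iff_classicalSE (g : G.Profile) :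
    (∃ (P : G.Kernels) (r : G.Rewards), IsModelBasedSE g P r) ↔
      ∃ μ : G.Beliefs, IsClassicalSE g μ := by
  constructor
  · rintro ⟨P, r, hrat, gs, Ps, rs, hfm, hc, hg, hP, hr⟩
    obtain ⟨φ, hφ, μs, μ, hμc, hμ⟩ :=
      exists_convergent_choice fun n => (hfm n).exists_beliefConsistent
    have hφ := hφ.tendsto_atTop
    exact ⟨μ, (rationalUnderModel_iff_rationalGiven (fun n => hfm (φ n)) (fun n => hc (φ n))
      (hg.comp hφ) (hP.comp hφ) (hr.comp hφ) hμc hμ).1 hrat,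
      gs ∘ φ, μs, fun n => hfm (φ n), hμc, hg.comp hφ, hμ⟩
  · rintro ⟨μ, hrat, gs, μs, hfm, hμc, hg, hμ⟩
    obtain ⟨φ, hφ, xs, ⟨P, r⟩, hc, hx⟩ := exists_convergent_choice
      (α := G.Kernels × G.Rewards) (p := fun n x => ModelConsistent (gs n) x.1 x.2)
      fun n => Prod.exists.2 (hfm n).exists_modelConsistent
    have hφ := hφ.tendsto_atTop
    exact ⟨P, r, (rationalUnderModel_iff_rationalGiven (fun n => hfm (φ n)) hc
      (hg.comp hφ) hx.fst_nhds hx.snd_nhds (fun n => hμc (φ n)) (hμ.comp hφ)).2 hrat,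
      gs ∘ φ, _, _, fun n => hfm (φ n), hc, hg.comp hφ, hx.fst_nhds, hx.snd_nhds⟩

end DynamicGame

end

theorem mainTheorem5 {ι : Type v} [Fintype ι] [LinearOrder ι] {T : ℕ}
    (G : DynamicGame.{u, v} ι T) (g : G.Profile) :
    List.TFAE [
      ∃ (P : G.Kernels) (r : G.Rewards), DynamicGame.IsModelBasedSE g P r,
      ∃ Q : G.QFunctions, DynamicGame.IsModelFreeSE g Q,
      ∃ Q : G.QFunctions, DynamicGame.IsModelFreeSE₂ g Q,
      ∃ μ : G.Beliefs, DynamicGame.IsClassicalSE g μ] := by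
  tfae_have 1 ↔ 2 := DynamicGame.exists_modelBasedSE_iff_modelFreeSE g
  tfae_have 1 ↔ 3 := DynamicGame.exists_modelBasedSE_iff_modelFreeSE₂ g
  tfae_have 1 ↔ 4 := DynamicGame.exists_modelBasedSE_iff_classicalSE g
  tfae_finish
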